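/- For integers $n,d,u\ge 1$ with $du\ge 2$, a dataset is $\mathcal D=(x_1,\dots,x_n)$ with $x_i\in\{0,1,\dots,u\}^d$, where user $i$ holds $x_i$. Write $f(\mathcal D)=\frac1n\sum_{i=1}^n x_i$ for its mean and $w(\mathcal D)=\max_{i,j}\|x_i-x_j\|_2$ for its diameter. A $3$-round protocol in the local model draws a public random seed independent of the data; then in each of three rounds every user sends one message, drawn by a local randomizer (a Markov kernel, with fresh independent randomness) from the seed, all messages of the earlier rounds, and the user's own datum only; finally an estimate $M(\mathcal D)\in\mathbb R^d$ is computed from the seed and all messages. For $\rho>0$ the protocol is $\rho$-zCDP if for every value of the seed, all datasets $\mathcal D,\mathcal D'$ that differ in exactly one user's datum, and all $\alpha>1$, the laws $\Pi(\mathcal D),\Pi(\mathcal D')$ of the transcript of all messages given the seed satisfy $D_\alpha(\Pi(\mathcal D)\,\|\,\Pi(\mathcal D'))\le\rho\alpha$, where $D_\alpha$ is the Rényi divergence of order $\alpha$. Theorem. There are absolute constants $c,C>0$ such that the following holds for all integers $n,d,u\ge1$ with $du\ge2$, all $\rho>0$ and all $\beta\in(0,1)$. Set $$\tau=\sqrt{n/\rho}\,\log^2(du)\,\log\frac{du}{\beta}$$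 and assume $n\ge c\,\tau\sqrt d$. Then there is a $3$-round $\rho$-zCDP protocol in the local model whose output $M(\mathcal D)$ satisfies, for every dataset $\mathcal D\in(\{0,1,\dots,u\}^d)^n$, $$\Pr\left[\|M(\mathcal D)-f(\mathcal D)\|_2\le C\left(\sqrt{\frac{dn}{\rho}}+\tau\right)\sqrt{\log\frac{nd}{\beta}}\cdot\frac{w(\mathcal D)}{n}\right]\ge 1-\beta .$$ -/

import Mathlib

open MeasureTheory ProbabilityTheory

namespace LDPMean

/-! ### Rényi divergence and zero-concentrated differential privacy -/

/-- The Rényi divergence `D_α(μ ‖ ν)` of order `α > 1` of two probability measures: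
`(α - 1)⁻¹ * log ∫ (dμ/dν)^α dν` if `μ ≪ ν`, and `∞` otherwise. -/
noncomputable def renyiDiv {Ω : Type*} [MeasurableSpace Ω] (α : ℝ) (μ ν : Measure Ω) : EReal :=
  open Classical in
  if μ ≪ ν then (((α - 1)⁻¹ : ℝ) : EReal) * ENNReal.log (∫⁻ ω, (μ.rnDeriv ν ω) ^ α ∂ν) else ⊤

/-- `ρ`-zCDP of a randomized map `M` (given by its output laws) on datasets of `n` data:
`D_α(M(D) ‖ M(D')) ≤ ρ α` for all `α > 1` and all datasets `D`, `D'` at Hamming distance `1`. -/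
def IsZCDP {n : ℕ} {X Ω : Type*} [DecidableEq X] [MeasurableSpace Ω] (ρ : ℝ)
    (M : (Fin n → X) → Measure Ω) : Prop :=
  ∀ D D' : Fin n → X, hammingDist D D' = 1 →
    ∀ α : ℝ, 1 < α → renyiDiv α (M D) (M D') ≤ ((ρ * α : ℝ) : EReal)

/-! ### Independent messages -/

/-- The kernel `a ↦ ∏ i, κ i a`: conditionally on `a`, independent draws from the `κ i a`. -/
noncomputable def piKernel {n : ℕ} {A B : Type*} [MeasurableSpace A] [MeasurableSpace B]
    (κ : Fin n → Kernel A B) [∀ i, IsMarkovKernel (κ i)] : Kernel A (Fin n → B) where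
  toFun a := Measure.pi fun i => κ i a
  measurable' := by
    refine Measurable.measure_of_isPiSystem_of_isProbabilityMeasure
      generateFrom_pi.symm isPiSystem_pi ?_
    rintro _ ⟨s, hs, rfl⟩
    simp only [Measure.pi_pi]
    exact Finset.measurable_prod _ fun i _ =>
      Kernel.measurable_coe (κ i) (hs i (Set.mem_univ i))

instance {n : ℕ} {A B : Type*} [MeasurableSpace A] [MeasurableSpace B]
    (κ : Fin n → Kernel A B) [∀ i, IsMarkovKernel (κ i)] : IsMarkovKernel (piKernel κ) :=
  ⟨fun a => by
    change IsProbabilityMeasure (Measure.pi fun i => κ i a)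
    infer_instance⟩

/-! ### Interactive protocols in the local model -/

/-- All messages sent by the `n` users in the first `t` rounds. -/
def History (n : ℕ) (Msg : Type) : ℕ → Type
  | 0 => Unit
  | t + 1 => History n Msg t × (Fin n → Msg)

instance History.instMeasurableSpace (n : ℕ) (Msg : Type) [MeasurableSpace Msg] :
    ∀ t : ℕ, MeasurableSpace (History n Msg t)
  | 0 => inferInstanceAs (MeasurableSpace Unit)
  | t + 1 =>
    letI := History.instMeasurableSpace n Msg t
    inferInstanceAs (MeasurableSpace (History n Msg t × (Fin n → Msg)))

/-- A `T`-round protocol in the local model for `n` users, each of whom holds one datum in `X`,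
with output in `Y`. There is a public random seed, independent of the data. In every round each
user sends one message, which is drawn by a local randomizer from the public information
(the seed and all messages of the earlier rounds) and from the user's own datum, with fresh
randomness. The output is computed from the seed and all the messages.
Only the randomizers of the rounds `t < T` are ever used. -/
structure LocalProtocol (n T : ℕ) (X Y : Type) [MeasurableSpace X] [MeasurableSpace Y] where
  Seed : Type
  Msg : Type
  [seedSpace : MeasurableSpace Seed]
  [msgSpace : MeasurableSpace Msg]
  seedLaw : Measure Seed
  [seedProb : IsProbabilityMeasure seedLaw]
  randomizer : ∀ t : ℕ, Kernel ((Seed × History n Msg t) × X) Msg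
  [randomizerMarkov : ∀ t, IsMarkovKernel (randomizer t)]
  output : Seed × History n Msg T → Y
  measurable_output : Measurable output

namespace LocalProtocol

attribute [instance] seedSpace msgSpace seedProb randomizerMarkov

variable {n T : ℕ} {X Y : Type} [MeasurableSpace X] [MeasurableSpace Y]

/-- The law of the message of a user with datum `v` in round `t`, given the public information. -/
noncomputable def message (P : LocalProtocol n T X Y) (t : ℕ) (v : X) :
    Kernel (P.Seed × History n P.Msg t) P.Msg :=
  (P.randomizer t).comap (fun h => (h, v)) (measurable_id.prodMk measurable_const)

instance (P : LocalProtocol n T X Y) (t : ℕ) (v : X) : IsMarkovKernel (P.message t v) :=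
  inferInstanceAs (IsMarkovKernel ((P.randomizer t).comap _ _))

/-- The law of the messages of all users in round `t`, given the public information. -/
noncomputable def round (P : LocalProtocol n T X Y) (D : Fin n → X) (t : ℕ) :
    Kernel (P.Seed × History n P.Msg t) (Fin n → P.Msg) :=
  piKernel fun i => P.message t (D i)

instance (P : LocalProtocol n T X Y) (D : Fin n → X) (t : ℕ) : IsMarkovKernel (P.round D t) :=
  inferInstanceAs (IsMarkovKernel (piKernel _))

/-- The law of all messages of the first `t` rounds on the dataset `D`, given the public seed. -/
noncomputable def history (P : LocalProtocol n T X Y) (D : Fin n → X) :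
    ∀ t : ℕ, Kernel P.Seed (History n P.Msg t)
  | 0 => Kernel.const P.Seed (Measure.dirac ())
  | t + 1 => (P.history D t).compProd (P.round D t)

instance (P : LocalProtocol n T X Y) (D : Fin n → X) (t : ℕ) : IsMarkovKernel (P.history D t) := by
  induction t with
  | zero => exact inferInstanceAs (IsMarkovKernel (Kernel.const P.Seed (Measure.dirac ())))
  | succ t ih => exact inferInstanceAs (IsMarkovKernel ((P.history D t).compProd (P.round D t)))

/-- The law of the transcript (all messages of all `T` rounds) on `D`, given the public seed. -/
noncomputable def transcript (P : LocalProtocol n T X Y) (D : Fin n → X) :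
    Kernel P.Seed (History n P.Msg T) :=
  P.history D T

/-- The joint law of the public seed and the transcript on the dataset `D`. -/
noncomputable def law (P : LocalProtocol n T X Y) (D : Fin n → X) :
    Measure (P.Seed × History n P.Msg T) :=
  P.seedLaw.compProd (P.transcript D)

/-- `ρ`-zCDP in the local model: whatever the value of the public seed, the transcript of all
messages of all rounds is `ρ`-zCDP. For `T = 1` this says that the local randomizer `R` satisfies
`D_α(R(v) ‖ R(v')) ≤ ρ α` for any two data `v`, `v'` and all `α > 1`. -/
def IsLocalZCDP [DecidableEq X] (P : LocalProtocol n T X Y) (ρ : ℝ) : Prop :=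
  ∀ s : P.Seed, IsZCDP ρ fun D => P.transcript D s

end LocalProtocol

/-! ### Mean estimation -/

/-- A datum: a vector with `d` coordinates in `{0, 1, …, u}`. -/
abbrev Datum (d u : ℕ) : Type := Fin d → Fin (u + 1)

/-- A datum as a point of Euclidean space. -/
def Datum.toPoint {d u : ℕ} (v : Datum d u) : EuclideanSpace ℝ (Fin d) :=
  WithLp.toLp 2 fun j => ((v j : ℕ) : ℝ)

/-- The mean `f(D) = (1/n) ∑ i, x i`. -/
noncomputable def mean {n d u : ℕ} (D : Fin n → Datum d u) : EuclideanSpace ℝ (Fin d) :=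
  (n : ℝ)⁻¹ • ∑ i, (D i).toPoint

/-- The diameter `w(D)`: the largest Euclidean distance between two data. -/
noncomputable def width {n d u : ℕ} (D : Fin n → Datum d u) : ℝ :=
  Metric.diam (Set.range fun i => (D i).toPoint)

/-- `τ = √(n/ρ) log²(du) log(du/β)`. -/
noncomputable def tau (n d u : ℕ) (ρ β : ℝ) : ℝ :=
  √(n / ρ) * Real.log (d * u) ^ 2 * Real.log (d * u / β)

end LDPMean

/-! All messages are Gaussian: a user sends a vector of norm at most `√(ρ/6)` plus standard normal
noise in every slot. Changing one datum costs at most `ρ/3` of the zCDP budget in each round,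
whatever the history, and adaptive composition over three rounds gives `ρ` (`gaussHistory_density`,
`gaussProtocol_isLocalZCDP`). Only sums over the users are used for the estimate. Outside an event
of probability at most `β`, the summed noise in each slot obeys a fixed bound
(`gaussHistory_not_noiseBounded_le`); the rest of the argument is deterministic.

Round 1 finds a center. Users vote on the bits of the reflected binary code of each coordinate, and
under the assumption on `n` the noise cannot overturn a three-quarters majority (`noiseBound_lt`).
Neighbouring numbers differ in a single bit of this code, and its lower bits are mirrored at every
cut; hence bits collected from different points of a cluster still decode to a number near the
cluster (`grayDecode_near`). Applying this to the three quarters of the users closest to a fixed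
datum bounds the squared error in a coordinate by 100 times the average squared distance to that
datum (`mul_sqDist_grayDecode_le`). Squared errors add up over coordinates, so the center is within
`10 w` of every datum, with no factor depending on `d`.

Round 2 finds a scale. Users report for each `k` whether their squared distance to the center is at
least `2 ^ k`, and the first level whose noisy count stays below the noise bound is taken. Few users
lie beyond it (`card_level_le`), yet it is at most a constant times the true scale, since every
lower level was reached by some datum (`sqrt_two_pow_level_le`).

Round 3 averages the differences from the center, rescaled by that radius; users beyond it send
zero. The error is the contribution of the `O(τ)` dropped users, each at most `10 w`, plus Gaussian
noise of norm about `√d` times its size in one coordinate, rescaled to order `w`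
(`norm_estimateFrom_sub_mean_le`). -/

namespace LDPMean

open scoped ENNReal

/-! ### Densities of product measures -/

lemma lintegral_pi_prod {ι : Type*} [Fintype ι] {Ω : ι → Type*} [∀ i, MeasurableSpace (Ω i)]
    (μ : ∀ i, Measure (Ω i)) [∀ i, IsProbabilityMeasure (μ i)] {f : ∀ i, Ω i → ℝ≥0∞}
    (hf : ∀ i, Measurable (f i)) :
    ∫⁻ x, ∏ i, f i (x i) ∂Measure.pi μ = ∏ i, ∫⁻ x, f i x ∂μ i := by
  refine (lintegral_prod_eq_prod_lintegral_of_indepFun Finset.univ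
    (fun i (x : ∀ i, Ω i) => f i (x i)) (iIndepFun_pi fun i => (hf i).aemeasurable)
    fun i => (hf i).comp (measurable_pi_apply i)).trans ?_
  refine Finset.prod_congr rfl fun i _ => ?_
  rw [← (measurePreserving_eval μ i).lintegral_comp (hf i)]

lemma pi_withDensity_eq {ι : Type*} [Fintype ι] {Ω : ι → Type*} [∀ i, MeasurableSpace (Ω i)]
    (μ : ∀ i, Measure (Ω i)) [∀ i, IsProbabilityMeasure (μ i)] {f : ∀ i, Ω i → ℝ≥0∞}
    (hf : ∀ i, Measurable (f i)) [∀ i, IsProbabilityMeasure ((μ i).withDensity (f i))] :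
    Measure.pi (fun i => (μ i).withDensity (f i)) =
      (Measure.pi μ).withDensity fun x => ∏ i, f i (x i) := by
  refine Measure.pi_eq fun s hs => ?_
  rw [withDensity_apply _ (MeasurableSet.univ_pi hs),
    ← lintegral_indicator (MeasurableSet.univ_pi hs)]
  have : (fun x => (Set.univ.pi s).indicator (fun x => ∏ i, f i (x i)) x) =
      fun x => ∏ i, (s i).indicator (f i) (x i) := by
    classical
    funext x
    by_cases hx : x ∈ Set.univ.pi s
    · rw [Set.indicator_of_mem hx]
      exact Finset.prod_congr rfl fun i _ => by
        rw [Set.indicator_of_mem (hx i (Set.mem_univ i))]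
    · rw [Set.indicator_of_notMem hx]
      simp only [Set.mem_pi, Set.mem_univ, true_imp_iff, not_forall] at hx
      obtain ⟨i, hi⟩ := hx
      exact (Finset.prod_eq_zero (Finset.mem_univ i) (Set.indicator_of_notMem hi _)).symm
  rw [this, lintegral_pi_prod μ fun i => (hf i).indicator (hs i)]
  exact Finset.prod_congr rfl fun i _ => by
    rw [withDensity_apply _ (hs i), lintegral_indicator (hs i)]

/-- The chain rule for likelihood ratios. It keeps the density of a whole transcript explicit, so
that its moments can be integrated round by round. -/
lemma compProd_eq_withDensity {A B : Type*} [MeasurableSpace A] [MeasurableSpace B]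
    {μ ν : Measure A} [SFinite μ] [SFinite ν] {κ η : Kernel A B} [IsSFiniteKernel κ]
    [IsSFiniteKernel η] {F : A → ℝ≥0∞} {G : A → B → ℝ≥0∞} (hF : Measurable F)
    (hG : Measurable (Function.uncurry G)) (hμ : μ = ν.withDensity F)
    (hκ : ∀ a, κ a = (η a).withDensity (G a)) :
    μ.compProd κ = (ν.compProd η).withDensity fun p => F p.1 * G p.1 p.2 := by
  have hm : Measurable fun p : A × B => F p.1 * G p.1 p.2 := (hF.comp measurable_fst).mul hG
  ext s hs
  rw [Measure.compProd_apply hs, withDensity_apply _ hs, ← lintegral_indicator hs,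
    Measure.lintegral_compProd (hm.indicator hs), hμ,
    lintegral_withDensity_eq_lintegral_mul _ hF (Kernel.measurable_kernel_prodMk_left hs)]
  refine lintegral_congr fun a => ?_
  have hsa : MeasurableSet (Prod.mk a ⁻¹' s) := measurable_prodMk_left hs
  have hGa : Measurable (G a) := hG.comp measurable_prodMk_left
  rw [Pi.mul_apply, hκ, withDensity_apply _ hsa, ← lintegral_indicator hsa,
    ← lintegral_const_mul _ (hGa.indicator hsa)]
  refine lintegral_congr fun b => ?_
  by_cases h : (a, b) ∈ s
  · rw [Set.indicator_of_mem h, Set.indicator_of_mem (show b ∈ Prod.mk a ⁻¹' s from h)]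
  · rw [Set.indicator_of_notMem h, Set.indicator_of_notMem (show b ∉ Prod.mk a ⁻¹' s from h),
      mul_zero]

/-! ### Gaussian likelihood ratios -/

/-- The density of the normal law `N(a, 1)` with respect to `N(b, 1)`. -/
noncomputable def gaussRatio (a b x : ℝ) : ℝ≥0∞ :=
  ENNReal.ofReal (Real.exp ((a - b) * (x - b) - (a - b) ^ 2 / 2))

lemma measurable_gaussRatio : Measurable fun p : (ℝ × ℝ) × ℝ => gaussRatio p.1.1 p.1.2 p.2 := by
  unfold gaussRatio
  fun_prop

lemma gaussianReal_eq_withDensity_gaussRatio (a b : ℝ) :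
    gaussianReal a 1 = (gaussianReal b 1).withDensity (gaussRatio a b) := by
  have hm : Measurable (gaussRatio a b) := by unfold gaussRatio; fun_prop
  rw [gaussianReal_of_var_ne_zero _ one_ne_zero, gaussianReal_of_var_ne_zero _ one_ne_zero,
    ← withDensity_mul _ (measurable_gaussianPDF _ _) hm]
  congr 1
  funext x
  rw [Pi.mul_apply, gaussianPDF, gaussianPDF, gaussRatio,
    ← ENNReal.ofReal_mul (gaussianPDFReal_nonneg _ _ _), gaussianPDFReal, gaussianPDFReal,
    mul_assoc _ (Real.exp _), ← Real.exp_add]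
  congr 3
  push_cast
  ring

/-- Exponential tilting: the `α`-th power of the ratio is a constant times the ratio for the mean `b
+ α (a - b)`, which integrates to one. -/
lemma lintegral_gaussRatio_rpow (a b α : ℝ) :
    ∫⁻ x, gaussRatio a b x ^ α ∂gaussianReal b 1 =
      ENNReal.ofReal (Real.exp (α * (α - 1) * ((a - b) ^ 2 / 2))) := by
  have h : ∀ x, gaussRatio a b x ^ α =
      ENNReal.ofReal (Real.exp (α * (α - 1) * ((a - b) ^ 2 / 2))) *
        gaussRatio (b + α * (a - b)) b x := by
    intro x
    rw [gaussRatio, gaussRatio, ENNReal.ofReal_rpow_of_pos (Real.exp_pos _), ← Real.exp_mul,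
      ← ENNReal.ofReal_mul (Real.exp_pos _).le, ← Real.exp_add]
    congr 2
    ring
  have hm : Measurable (gaussRatio (b + α * (a - b)) b) := by unfold gaussRatio; fun_prop
  have h1 : ∫⁻ x, gaussRatio (b + α * (a - b)) b x ∂gaussianReal b 1 = 1 := by
    rw [← setLIntegral_univ, ← withDensity_apply _ MeasurableSet.univ,
      ← gaussianReal_eq_withDensity_gaussRatio, measure_univ]
  simp_rw [h]
  rw [lintegral_const_mul _ hm, h1, mul_one]

/-- The density of `∏ i, ∏ k, N(a i k, 1)` with respect to `∏ i, ∏ k, N(b i k, 1)`. -/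
noncomputable def gaussRatioPi {ι κ : Type*} [Fintype ι] [Fintype κ] (a b x : ι → κ → ℝ) : ℝ≥0∞ :=
  ∏ i, ∏ k, gaussRatio (a i k) (b i k) (x i k)

section

variable {ι κ : Type*} [Fintype ι] [Fintype κ]

lemma pi_gaussianReal_eq_withDensity (a b : ι → κ → ℝ) :
    Measure.pi (fun i => Measure.pi fun k => gaussianReal (a i k) 1) =
      (Measure.pi fun i => Measure.pi fun k => gaussianReal (b i k) 1).withDensity
        (gaussRatioPi a b) := by
  have hm : ∀ a b : ℝ, Measurable (gaussRatio a b) := fun a b => by unfold gaussRatio; fun_prop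
  have h1 : ∀ i, Measure.pi (fun k => gaussianReal (a i k) 1) =
      (Measure.pi fun k => gaussianReal (b i k) 1).withDensity
        fun x => ∏ k, gaussRatio (a i k) (b i k) (x k) := by
    intro i
    have : ∀ k, IsProbabilityMeasure
        ((gaussianReal (b i k) 1).withDensity (gaussRatio (a i k) (b i k))) := fun k => by
      rw [← gaussianReal_eq_withDensity_gaussRatio]; infer_instance
    rw [← pi_withDensity_eq _ fun k => hm _ _]
    congr 1
    funext k
    exact gaussianReal_eq_withDensity_gaussRatio _ _
  have : ∀ i, IsProbabilityMeasure ((Measure.pi fun k => gaussianReal (b i k) 1).withDensity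
        fun x => ∏ k, gaussRatio (a i k) (b i k) (x k)) := fun i => by
    rw [← h1]; infer_instance
  simp_rw [h1]
  rw [pi_withDensity_eq]
  · rfl
  · exact fun i => Finset.measurable_prod _ fun k _ => (hm _ _).comp (measurable_pi_apply k)

lemma lintegral_gaussRatioPi_rpow (a b : ι → κ → ℝ) {α : ℝ} (hα : 0 < α) :
    ∫⁻ x, gaussRatioPi a b x ^ α
        ∂(Measure.pi fun i => Measure.pi fun k => gaussianReal (b i k) 1) =
      ENNReal.ofReal (Real.exp (α * (α - 1) * ∑ i, ∑ k, (a i k - b i k) ^ 2 / 2)) := by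
  have hm : ∀ a b : ℝ, Measurable fun x => gaussRatio a b x ^ α := fun a b => by
    unfold gaussRatio; fun_prop
  simp_rw [gaussRatioPi, ← ENNReal.prod_rpow_of_nonneg hα.le]
  rw [lintegral_pi_prod (fun i => Measure.pi fun k => gaussianReal (b i k) 1)
    (f := fun i x => ∏ k, gaussRatio (a i k) (b i k) (x k) ^ α)
    fun i => Finset.measurable_prod _ fun k _ => (hm _ _).comp (measurable_pi_apply k)]
  rw [Finset.mul_sum, Real.exp_sum, ENNReal.ofReal_prod_of_nonneg fun _ _ => (Real.exp_pos _).le]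
  refine Finset.prod_congr rfl fun i _ => ?_
  rw [lintegral_pi_prod (fun k => gaussianReal (b i k) 1)
    (f := fun k x => gaussRatio (a i k) (b i k) x ^ α) fun k => hm _ _]
  rw [Finset.mul_sum, Real.exp_sum, ENNReal.ofReal_prod_of_nonneg fun _ _ => (Real.exp_pos _).le]
  exact Finset.prod_congr rfl fun k _ => lintegral_gaussRatio_rpow _ _ _

end

/-! ### Rényi divergence from a density -/

lemma renyiDiv_withDensity_le {Ω : Type*} [MeasurableSpace Ω] {α ρ : ℝ} (hα : 1 < α)
    (ν : Measure Ω) [SigmaFinite ν] {F : Ω → ℝ≥0∞} (hF : Measurable F)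
    (h : ∫⁻ x, F x ^ α ∂ν ≤ ENNReal.ofReal (Real.exp (α * (α - 1) * ρ))) :
    renyiDiv α (ν.withDensity F) ν ≤ ((ρ * α : ℝ) : EReal) := by
  have hα' : 0 < α - 1 := by linarith
  rw [renyiDiv, if_pos (withDensity_absolutelyContinuous _ _),
    lintegral_congr_ae ((ν.rnDeriv_withDensity hF).mono fun x hx => by
      show (ν.withDensity F).rnDeriv ν x ^ α = F x ^ α
      rw [hx])]
  have h1 : ENNReal.log (∫⁻ x, F x ^ α ∂ν) ≤ ((α * (α - 1) * ρ : ℝ) : EReal) := by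
    refine (ENNReal.log_monotone h).trans ?_
    rw [ENNReal.log_ofReal_of_pos (Real.exp_pos _), Real.log_exp]
  refine (mul_le_mul_of_nonneg_left h1 (by exact_mod_cast (inv_pos.2 hα').le)).trans ?_
  rw [← EReal.coe_mul, EReal.coe_le_coe_iff]
  apply le_of_eq
  field_simp

/-! ### Tail bounds for sums of Gaussian messages -/

lemma hasSubgaussianMGF_gaussianReal_zero_one : HasSubgaussianMGF id 1 (gaussianReal 0 1) where
  integrable_exp_mul t := integrable_exp_mul_gaussianReal t
  mgf_le t := by rw [mgf_id_gaussianReal]; simp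

lemma measurePreserving_eval_eval_sub {n : ℕ} {ι : Type*} [Fintype ι] (a : Fin n → ι → ℝ)
    (i : Fin n) (k : ι) :
    MeasurePreserving (fun m : Fin n → ι → ℝ => m i k - a i k)
      (Measure.pi fun i => Measure.pi fun k => gaussianReal (a i k) 1) (gaussianReal 0 1) := by
  have h1 := measurePreserving_eval (fun i => Measure.pi fun k => gaussianReal (a i k) 1) i
  have h2 := measurePreserving_eval (fun k => gaussianReal (a i k) 1) k
  have h3 : MeasurePreserving (fun x => x - a i k) (gaussianReal (a i k) 1) (gaussianReal 0 1) :=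
    ⟨by fun_prop, by rw [gaussianReal_map_sub_const, sub_self]⟩
  exact h3.comp (h2.comp h1)

/-- The centered messages are independent and sub-Gaussian with parameter 1, so their sum has
parameter `n`; the factor 2 accounts for the two tails. -/
lemma measure_abs_sum_sub_gt_le {n : ℕ} {ι : Type*} [Fintype ι] (a : Fin n → ι → ℝ) (k : ι)
    {T : ℝ} (hT : 0 ≤ T) :
    (Measure.pi fun i => Measure.pi fun k => gaussianReal (a i k) 1)
        {m | T < |∑ i, (m i k - a i k)|} ≤ ENNReal.ofReal (2 * Real.exp (-T ^ 2 / (2 * n))) := by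
  set ν := Measure.pi fun i => Measure.pi fun k => gaussianReal (a i k) 1 with hν
  have hX : ∀ i, HasSubgaussianMGF (fun m : Fin n → ι → ℝ => m i k - a i k) 1 ν := fun i => by
    have hp := measurePreserving_eval_eval_sub a i k
    have := hasSubgaussianMGF_gaussianReal_zero_one
    rw [← hp.map_eq] at this
    exact HasSubgaussianMGF.of_map hp.measurable.aemeasurable this
  have hind : iIndepFun (fun i (m : Fin n → ι → ℝ) => m i k - a i k) ν :=
    iIndepFun_pi (X := fun i (x : ι → ℝ) => x k - a i k) fun i =>
      ((measurable_pi_apply k).sub_const _).aemeasurable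
  have hsum := HasSubgaussianMGF.sum_of_iIndepFun hind (c := fun _ => 1) (s := Finset.univ)
    fun i _ => hX i
  have hup := hsum.measure_ge_le hT
  have hdown := hsum.neg.measure_ge_le hT
  simp only [Finset.sum_const, Finset.card_univ, Fintype.card_fin, nsmul_eq_mul, mul_one,
    NNReal.coe_natCast] at hup hdown
  refine (measure_mono (t := {m | T ≤ ∑ i, (m i k - a i k)} ∪
    {m | T ≤ -∑ i, (m i k - a i k)}) fun m hm => ?_).trans ((measure_union_le _ _).trans ?_)
  · have hm' : T < |∑ i, (m i k - a i k)| := hm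
    rcases lt_abs.1 hm' with h | h
    · exact Or.inl h.le
    · exact Or.inr h.le
  · rw [two_mul, ENNReal.ofReal_add (Real.exp_pos _).le (Real.exp_pos _).le]
    refine add_le_add ?_ ?_
    · rw [← ofReal_measureReal]; exact ENNReal.ofReal_le_ofReal hup
    · rw [← ofReal_measureReal]; exact ENNReal.ofReal_le_ofReal hdown

/-! ### Protocols with Gaussian messages -/

/-- The kernel that adds independent standard normal noise to the coordinates of `φ a`. -/
noncomputable def gaussKernel {A ι : Type*} [MeasurableSpace A] [Fintype ι] (φ : A → ι → ℝ)
    (hφ : Measurable φ) : Kernel A (ι → ℝ) where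
  toFun a := Measure.pi fun k => gaussianReal (φ a k) 1
  measurable' := by
    refine Measurable.measure_of_isPiSystem_of_isProbabilityMeasure
      generateFrom_pi.symm isPiSystem_pi ?_
    rintro _ ⟨s, hs, rfl⟩
    simp only [Measure.pi_pi]
    refine Finset.measurable_prod _ fun k _ => ?_
    have h : Measurable fun a => gaussianReal (φ a k) 1 :=
      measurable_gaussianReal.comp (((measurable_pi_apply k).comp hφ).prodMk measurable_const)
    have hk : MeasurableSet (s k) := hs k (Set.mem_univ k)
    exact (Measure.measurable_coe hk).comp h

instance {A ι : Type*} [MeasurableSpace A] [Fintype ι] (φ : A → ι → ℝ) (hφ : Measurable φ) :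
    IsMarkovKernel (gaussKernel φ hφ) :=
  ⟨fun a => by
    change IsProbabilityMeasure (Measure.pi fun k => gaussianReal (φ a k) 1)
    infer_instance⟩

section

variable {n T : ℕ} {ι X Y : Type} [Fintype ι] [MeasurableSpace X] [MeasurableSpace Y]

/-- The protocol without public randomness in which a user with datum `v` sends
`φ t h v + N(0, I)` in round `t` after the history `h`. -/
noncomputable def gaussProtocol (φ : ∀ t, History n (ι → ℝ) t → X → ι → ℝ)
    (hφ : ∀ t, Measurable fun p : History n (ι → ℝ) t × X => φ t p.1 p.2)
    (out : History n (ι → ℝ) T → Y) (hout : Measurable out) : LocalProtocol n T X Y where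
  Seed := Unit
  Msg := ι → ℝ
  seedLaw := Measure.dirac ()
  randomizer t := gaussKernel (fun p => φ t p.1.2 p.2)
    ((hφ t).comp ((measurable_snd.comp measurable_fst).prodMk measurable_snd))
  randomizerMarkov _ := inferInstance
  output p := out p.2
  measurable_output := hout.comp measurable_snd

variable (φ : ∀ t, History n (ι → ℝ) t → X → ι → ℝ)
    (hφ : ∀ t, Measurable fun p : History n (ι → ℝ) t × X => φ t p.1 p.2)
    (out : History n (ι → ℝ) T → Y) (hout : Measurable out)

lemma LocalProtocol.history_succ (P : LocalProtocol n T X Y) (D : Fin n → X) (t : ℕ)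
    (s : P.Seed) :
    P.history D (t + 1) s = (P.history D t s).compProd (Kernel.sectR (P.round D t) s) :=
  Kernel.compProd_apply_eq_compProd_sectR _ _ _

/-- The law of the Gaussian messages of all users in round `t`, given the history. -/
noncomputable def gaussRound (D : Fin n → X) (t : ℕ) :
    Kernel (History n (ι → ℝ) t) (Fin n → ι → ℝ) :=
  piKernel fun i => gaussKernel (fun h => φ t h (D i))
    ((hφ t).comp (measurable_id.prodMk measurable_const))

instance (D : Fin n → X) (t : ℕ) : IsMarkovKernel (gaussRound φ hφ D t) :=
  inferInstanceAs (IsMarkovKernel (piKernel _))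

lemma gaussRound_apply (D : Fin n → X) (t : ℕ) (h : History n (ι → ℝ) t) :
    gaussRound φ hφ D t h =
      Measure.pi fun i => Measure.pi fun k => gaussianReal (φ t h (D i) k) 1 := rfl

/-- The law of the Gaussian messages of the first `t` rounds. -/
noncomputable def gaussHistory (D : Fin n → X) : ∀ t, Measure (History n (ι → ℝ) t)
  | 0 => Measure.dirac ()
  | t + 1 => (gaussHistory D t).compProd (gaussRound φ hφ D t)

instance (D : Fin n → X) (t : ℕ) : IsProbabilityMeasure (gaussHistory φ hφ D t) := by
  induction t with
  | zero => exact inferInstanceAs (IsProbabilityMeasure (Measure.dirac ()))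
  | succ t ih =>
    exact inferInstanceAs
      (IsProbabilityMeasure ((gaussHistory φ hφ D t).compProd (gaussRound φ hφ D t)))

lemma gaussProtocol_history (D : Fin n → X) (t : ℕ) (s : (gaussProtocol φ hφ out hout).Seed) :
    (gaussProtocol φ hφ out hout).history D t s = gaussHistory φ hφ D t := by
  induction t with
  | zero => rfl
  | succ t ih =>
    rw [LocalProtocol.history_succ, ih]
    rfl

include hφ in
lemma measurable_gaussRatioPi_history (D D' : Fin n → X) (t : ℕ) :
    Measurable (Function.uncurry fun (h : History n (ι → ℝ) t) (m : Fin n → ι → ℝ) =>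
      gaussRatioPi (fun i => φ t h (D i)) (fun i => φ t h (D' i)) m) := by
  change Measurable fun p : History n (ι → ℝ) t × (Fin n → ι → ℝ) =>
    ∏ i, ∏ k, gaussRatio (φ t p.1 (D i) k) (φ t p.1 (D' i) k) (p.2 i k)
  refine Finset.measurable_prod _ fun i _ => Finset.measurable_prod _ fun k _ => ?_
  have h1 : ∀ v, Measurable fun p : History n (ι → ℝ) t × (Fin n → ι → ℝ) => φ t p.1 v k :=
    fun v => (measurable_pi_apply k).comp ((hφ t).comp (measurable_fst.prodMk measurable_const))
  have h2 : Measurable fun p : History n (ι → ℝ) t × (Fin n → ι → ℝ) => p.2 i k :=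
    (measurable_pi_apply k).comp ((measurable_pi_apply i).comp measurable_snd)
  exact measurable_gaussRatio.comp (((h1 (D i)).prodMk (h1 (D' i))).prodMk h2)

/-- Adaptive composition. Given the history, the `α`-moment of the next ratio is at most `exp (α (α
- 1) r)`; this bound does not depend on the history, so it factors out of the integral. -/
lemma gaussHistory_density (D D' : Fin n → X) {α r : ℝ} (hα : 1 < α)
    (hr : ∀ t h, ∑ i, ∑ k, (φ t h (D i) k - φ t h (D' i) k) ^ 2 / 2 ≤ r) (t : ℕ) :
    ∃ F : History n (ι → ℝ) t → ℝ≥0∞, Measurable F ∧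
      gaussHistory φ hφ D t = (gaussHistory φ hφ D' t).withDensity F ∧
      ∫⁻ h, F h ^ α ∂(gaussHistory φ hφ D' t) ≤
        ENNReal.ofReal (Real.exp (α * (α - 1) * (t * r))) := by
  have hα' : 0 ≤ α * (α - 1) := by nlinarith
  induction t with
  | zero =>
    refine ⟨fun _ => 1, measurable_const, ?_, ?_⟩
    · exact withDensity_one.symm
    · simp [ENNReal.one_rpow]
  | succ t ih =>
    obtain ⟨F, hF, hFd, hFm⟩ := ih
    set G : History n (ι → ℝ) t → (Fin n → ι → ℝ) → ℝ≥0∞ := fun h m =>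
      gaussRatioPi (fun i => φ t h (D i)) (fun i => φ t h (D' i)) m
    have hG : Measurable (Function.uncurry G) := measurable_gaussRatioPi_history φ hφ D D' t
    have hFG : Measurable fun p : History n (ι → ℝ) t × (Fin n → ι → ℝ) => F p.1 * G p.1 p.2 :=
      (hF.comp measurable_fst).mul hG
    refine ⟨fun p => F p.1 * G p.1 p.2, hFG,
      compProd_eq_withDensity hF hG hFd fun h => pi_gaussianReal_eq_withDensity _ _, ?_⟩
    · refine (Measure.lintegral_compProd (μ := gaussHistory φ hφ D' t)
        (κ := gaussRound φ hφ D' t) (hFG.pow_const α)).trans_le ?_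
      have hin : ∀ h, ∫⁻ m, (F h * G h m) ^ α ∂(gaussRound φ hφ D' t h) ≤
          F h ^ α * ENNReal.ofReal (Real.exp (α * (α - 1) * r)) := by
        intro h
        simp_rw [ENNReal.mul_rpow_of_nonneg _ _ (zero_le_one.trans hα.le)]
        have hGh : Measurable (G h) := hG.of_uncurry_left
        rw [lintegral_const_mul _ (hGh.pow_const α)]
        refine mul_le_mul_right ?_ _
        have hGm := lintegral_gaussRatioPi_rpow (fun i => φ t h (D i)) (fun i => φ t h (D' i))
          (zero_lt_one.trans hα)
        rw [gaussRound_apply]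
        rw [hGm]
        exact ENNReal.ofReal_le_ofReal
          (Real.exp_le_exp.2 (mul_le_mul_of_nonneg_left (hr t h) hα'))
      refine (lintegral_mono hin).trans ?_
      rw [lintegral_mul_const _ (hF.pow_const α)]
      refine (mul_le_mul_left hFm _).trans ?_
      rw [← ENNReal.ofReal_mul (Real.exp_pos _).le, ← Real.exp_add]
      apply le_of_eq
      congr 2
      push_cast
      ring

/-- If the noiseless messages have squared norm at most `ρ / (2 T)`, then the protocol with
Gaussian messages is `ρ`-zCDP. -/
theorem gaussProtocol_isLocalZCDP [DecidableEq X] {ρ : ℝ} (hT : 0 < T)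
    (hb : ∀ t h v, ∑ k, φ t h v k ^ 2 ≤ ρ / (2 * T)) :
    (gaussProtocol φ hφ out hout).IsLocalZCDP ρ := by
  intro s D D' hDD α hα
  have hT' : (0 : ℝ) < T := by exact_mod_cast hT
  obtain ⟨i₀, hi₀⟩ : ∃ i₀, ∀ i, i ≠ i₀ → D i = D' i := by
    rw [hammingDist, Finset.card_eq_one] at hDD
    obtain ⟨i₀, h⟩ := hDD
    refine ⟨i₀, fun i hi => by_contra fun hne => hi ?_⟩
    have : i ∈ ({i₀} : Finset (Fin n)) := h ▸ Finset.mem_filter.2 ⟨Finset.mem_univ i, hne⟩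
    simpa using this
  have hr : ∀ t h, ∑ i, ∑ k, (φ t h (D i) k - φ t h (D' i) k) ^ 2 / 2 ≤ ρ / T := by
    intro t h
    rw [Finset.sum_eq_single i₀ (fun i _ hi => by simp [hi₀ i hi])
      (fun h => absurd (Finset.mem_univ _) h)]
    -- Two vectors of squared norm at most `ρ / (2 T)` are compared through `(x - y)² / 2 ≤ x² +
    -- y²`.
    calc ∑ k, (φ t h (D i₀) k - φ t h (D' i₀) k) ^ 2 / 2
        ≤ ∑ k, (φ t h (D i₀) k ^ 2 + φ t h (D' i₀) k ^ 2) := by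
          refine Finset.sum_le_sum fun k _ => ?_
          nlinarith [sq_nonneg (φ t h (D i₀) k + φ t h (D' i₀) k)]
      _ ≤ ρ / (2 * T) + ρ / (2 * T) := by
          rw [Finset.sum_add_distrib]
          exact add_le_add (hb _ _ _) (hb _ _ _)
      _ = ρ / T := by field_simp; norm_num
  obtain ⟨F, hF, hFd, hFm⟩ := gaussHistory_density φ hφ D D' hα hr T
  rw [mul_div_cancel₀ _ hT'.ne'] at hFm
  have key := renyiDiv_withDensity_le hα _ hF hFm
  rw [← hFd] at key
  change renyiDiv α ((gaussProtocol φ hφ out hout).history D T s)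
    ((gaussProtocol φ hφ out hout).history D' T s) ≤ _
  rw [gaussProtocol_history, gaussProtocol_history]
  exact key

/-- In each of the first `t` rounds, the total noise in coordinate `k` is at most `B k`. -/
def NoiseBounded (D : Fin n → X) (B : ι → ℝ) : ∀ t, History n (ι → ℝ) t → Prop
  | 0, _ => True
  | t + 1, ⟨h, m⟩ => NoiseBounded D B t h ∧ ∀ k, |∑ i, (m i k - φ t h (D i) k)| ≤ B k

include hφ in
lemma measurableSet_noiseBounded (D : Fin n → X) (B : ι → ℝ) (t : ℕ) :
    MeasurableSet {h | NoiseBounded φ D B t h} := by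
  induction t with
  | zero => exact MeasurableSet.univ
  | succ t ih =>
    have h1 : MeasurableSet {p : History n (ι → ℝ) t × (Fin n → ι → ℝ) |
        NoiseBounded φ D B t p.1} := measurable_fst ih
    have h2 : MeasurableSet {p : History n (ι → ℝ) t × (Fin n → ι → ℝ) |
        ∀ k, |∑ i, (p.2 i k - φ t p.1 (D i) k)| ≤ B k} := by
      rw [Set.ofPred_forall]
      refine MeasurableSet.iInter fun k => measurableSet_le ?_ measurable_const
      have h3 : ∀ i, Measurable fun p : History n (ι → ℝ) t × (Fin n → ι → ℝ) =>
          p.2 i k - φ t p.1 (D i) k := fun i =>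
        ((measurable_pi_apply k).comp ((measurable_pi_apply i).comp measurable_snd)).sub
          ((measurable_pi_apply k).comp ((hφ t).comp (measurable_fst.prodMk measurable_const)))
      exact (Finset.measurable_sum _ fun i _ => h3 i).abs
    exact h1.inter h2

/-- A union bound over rounds and slots. The messages of a round depend on the past, but given the
past their noise is centered Gaussian, so the conditional tail bound is the same for every history.
-/
lemma gaussHistory_not_noiseBounded_le (D : Fin n → X) {B : ι → ℝ} (hB : ∀ k, 0 ≤ B k)
    (t : ℕ) :
    gaussHistory φ hφ D t {h | ¬ NoiseBounded φ D B t h} ≤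
      t * ENNReal.ofReal (∑ k, 2 * Real.exp (-B k ^ 2 / (2 * n))) := by
  induction t with
  | zero => simp [NoiseBounded]
  | succ t ih =>
    set δ := ENNReal.ofReal (∑ k, 2 * Real.exp (-B k ^ 2 / (2 * n)))
    set bad : Set (History n (ι → ℝ) t × (Fin n → ι → ℝ)) :=
      {p | ¬ NoiseBounded φ D B (t + 1) p}
    have hbad : MeasurableSet bad := (measurableSet_noiseBounded φ hφ D B (t + 1)).compl
    have hbad' : MeasurableSet {h | ¬ NoiseBounded φ D B t h} :=
      (measurableSet_noiseBounded φ hφ D B t).compl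
    refine (Measure.compProd_apply (μ := gaussHistory φ hφ D t) (κ := gaussRound φ hφ D t)
      hbad).trans_le ?_
    -- A bad past is charged in full; after a good past only the noise of the current round can
    -- fail, with probability at most `δ`.
    have key : ∀ h, gaussRound φ hφ D t h (Prod.mk h ⁻¹' bad) ≤
        {h | ¬ NoiseBounded φ D B t h}.indicator 1 h + δ := by
      intro h
      by_cases hh : NoiseBounded φ D B t h
      · refine le_add_left ?_
        refine (measure_mono (t := ⋃ k, {m : Fin n → ι → ℝ |
          B k < |∑ i, (m i k - φ t h (D i) k)|}) fun m hm => ?_).trans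
            ((measure_iUnion_fintype_le _ _).trans ?_)
        · by_contra hcon
          simp only [Set.mem_iUnion, Set.mem_ofPred_eq, not_exists, not_lt] at hcon
          exact hm ⟨hh, hcon⟩
        · rw [show δ = ∑ k, ENNReal.ofReal (2 * Real.exp (-B k ^ 2 / (2 * n))) from
            ENNReal.ofReal_sum_of_nonneg fun k _ => by positivity]
          exact Finset.sum_le_sum fun k _ =>
            measure_abs_sum_sub_gt_le (fun i => φ t h (D i)) k (hB k)
      · rw [Set.indicator_of_mem (show h ∈ {h | ¬ NoiseBounded φ D B t h} from hh)]
        exact le_add_right prob_le_one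
    refine (lintegral_mono key).trans ?_
    rw [lintegral_add_right _ measurable_const, lintegral_indicator_one hbad', lintegral_const,
      measure_univ, mul_one]
    push_cast
    rw [add_mul, one_mul]
    exact add_le_add_left ih _

/-- With high probability, the noise in a protocol with Gaussian messages is bounded. -/
theorem le_gaussProtocol_law (D : Fin n → X) {B : ι → ℝ} (hB : ∀ k, 0 ≤ B k) {β : ℝ}
    (hβ : T * ∑ k, 2 * Real.exp (-B k ^ 2 / (2 * n)) ≤ β) (hβ1 : 0 ≤ β)
    {S : Set Y} (hS : MeasurableSet S)
    (h : ∀ h, NoiseBounded φ D B T h → out h ∈ S) :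
    1 - β ≤ ((gaussProtocol φ hφ out hout).law D).real
      {ω | (gaussProtocol φ hφ out hout).output ω ∈ S} := by
  set P := gaussProtocol φ hφ out hout
  have hmarkov : IsMarkovKernel (P.transcript D) :=
    inferInstanceAs (IsMarkovKernel (P.history D T))
  have hprob : IsProbabilityMeasure (P.law D) :=
    inferInstanceAs (IsProbabilityMeasure (P.seedLaw.compProd (P.transcript D)))
  have hms : MeasurableSet {ω | P.output ω ∈ S} := P.measurable_output hS
  rw [← compl_compl {ω | P.output ω ∈ S}, probReal_compl_eq_one_sub hms.compl]
  refine sub_le_sub_left (ENNReal.toReal_le_of_le_ofReal hβ1 ?_) 1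
  refine (Measure.compProd_apply hms.compl).trans_le ?_
  have key : ∀ s, P.transcript D s (Prod.mk s ⁻¹' {ω | P.output ω ∈ S}ᶜ) ≤
      ENNReal.ofReal β := by
    intro s
    change P.history D T s _ ≤ _
    rw [gaussProtocol_history]
    have hsub : (Prod.mk s ⁻¹' {ω | P.output ω ∈ S}ᶜ : Set (History n (ι → ℝ) T)) ⊆
        {h | ¬ NoiseBounded φ D B T h} := by
      intro h' hh' hcon
      exact (show ¬ out h' ∈ S from hh') (h h' hcon)
    refine (measure_mono hsub).trans ((gaussHistory_not_noiseBounded_le φ hφ D hB T).trans ?_)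
    rw [← ENNReal.ofReal_natCast, ← ENNReal.ofReal_mul (Nat.cast_nonneg _)]
    exact ENNReal.ofReal_le_ofReal hβ
  refine (lintegral_mono key).trans ?_
  rw [lintegral_const, measure_univ, mul_one]

end

/-! ### The reflected binary code -/

/-- The reflection of `[0, 2 ^ (L + 1))` onto `[0, 2 ^ L)`. -/
def reflect (L x : ℕ) : ℕ := if x < 2 ^ L then x else 2 ^ (L + 1) - 1 - x

/-- Bit `l` of the reflected binary code (Gray code) with `L` bits. -/
def grayBit : ℕ → ℕ → ℕ → Bool
  | 0, _, _ => false
  | L + 1, l, x => if l = L then decide (2 ^ L ≤ x) else grayBit L l (reflect L x)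

/-- The number with the given `L` bits in the reflected binary code. -/
def grayDecode : ℕ → (ℕ → Bool) → ℕ
  | 0, _ => 0
  | L + 1, v => if v L then 2 ^ (L + 1) - 1 - grayDecode L v else grayDecode L v

lemma grayDecode_lt (L : ℕ) (v : ℕ → Bool) : grayDecode L v < 2 ^ L := by
  induction L with
  | zero => simp [grayDecode]
  | succ L ih =>
    have := pow_succ 2 L
    rw [grayDecode]
    split <;> omega

lemma exists_mem_image_reflect {L : ℕ} {v : ℕ → Bool} {S : Set ℕ}
    (h : ∀ l < L + 1, ∃ x ∈ S, grayBit (L + 1) l x = v l) :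
    ∀ l < L, ∃ x ∈ reflect L '' S, grayBit L l x = v l := by
  intro l hl
  obtain ⟨x, hx, hxv⟩ := h l (by omega)
  rw [grayBit, if_neg (by omega)] at hxv
  exact ⟨_, Set.mem_image_of_mem _ hx, hxv⟩

lemma exists_mem_top_bit {L : ℕ} {v : ℕ → Bool} {S : Set ℕ}
    (h : ∀ l < L + 1, ∃ x ∈ S, grayBit (L + 1) l x = v l) :
    ∃ x ∈ S, v L = decide (2 ^ L ≤ x) := by
  obtain ⟨x, hx, hxv⟩ := h L (by omega)
  rw [grayBit, if_pos rfl] at hxv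
  exact ⟨x, hx, hxv.symm⟩

/-- Near the lower end of the range the top bit is 0 on all of `S`, so it is decoded correctly and
folding changes nothing. Once `m` reaches the midpoint, `2 * m` exceeds every possible output. -/
lemma grayDecode_le_of_forall_le {L m : ℕ} {v : ℕ → Bool} {S : Set ℕ} (hm : ∀ x ∈ S, x ≤ m)
    (h : ∀ l < L, ∃ x ∈ S, grayBit L l x = v l) : grayDecode L v ≤ 2 * m := by
  induction L generalizing S with
  | zero => simp [grayDecode]
  | succ L ih =>
    have hp := pow_succ 2 L
    by_cases hmL : m < 2 ^ L
    · obtain ⟨x, hx, hxv⟩ := exists_mem_top_bit h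
      have hv : v L = false := by
        rw [hxv, decide_eq_false_iff_not]
        have := hm x hx
        omega
      rw [grayDecode, hv, if_neg (by simp)]
      refine ih ?_ (exists_mem_image_reflect h)
      rintro _ ⟨y, hy, rfl⟩
      have := hm y hy
      rw [reflect, if_pos (by omega)]
      exact this
    · have := grayDecode_lt (L + 1) v
      omega

/-- The counterpart at the upper end: the top bit is 1 on all of `S`, and the reflection moves `S`
to the lower end, where `grayDecode_le_of_forall_le` applies. -/
lemma le_grayDecode_add_of_forall_le {L m : ℕ} {v : ℕ → Bool} {S : Set ℕ}
    (hS : ∀ x ∈ S, x < 2 ^ L) (hm : ∀ x ∈ S, 2 ^ L - 1 ≤ x + m)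
    (h : ∀ l < L, ∃ x ∈ S, grayBit L l x = v l) : 2 ^ L - 1 ≤ grayDecode L v + 2 * m := by
  cases L with
  | zero => simp
  | succ L =>
    have hp := pow_succ 2 L
    by_cases hmL : m < 2 ^ L
    · obtain ⟨x, hx, hxv⟩ := exists_mem_top_bit h
      have hv : v L = true := by
        rw [hxv, decide_eq_true_eq]
        have := hm x hx
        omega
      have key : grayDecode L v ≤ 2 * m := by
        refine grayDecode_le_of_forall_le ?_ (exists_mem_image_reflect h)
        rintro _ ⟨y, hy, rfl⟩
        have := hm y hy
        rw [reflect]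
        split <;> omega
      have := grayDecode_lt L v
      rw [grayDecode, hv, if_pos rfl]
      omega
    · omega

/-- If every bit occurs in the code of a point of `S`, and `S` lies within distance `s` of `a`,
then decoding yields a number within distance `5 s` of `a`. -/
lemma grayDecode_near {L a s : ℕ} {v : ℕ → Bool} {S : Set ℕ} (ha : a < 2 ^ L)
    (hS : ∀ x ∈ S, x < 2 ^ L) (hs : ∀ x ∈ S, x ≤ a + s ∧ a ≤ x + s)
    (h : ∀ l < L, ∃ x ∈ S, grayBit L l x = v l) :
    grayDecode L v ≤ a + 5 * s ∧ a ≤ grayDecode L v + 5 * s := by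
  induction L generalizing S a with
  | zero => simp at ha; simp [grayDecode, ha]
  | succ L ih =>
    have hp := pow_succ 2 L
    have hdec := grayDecode_lt L v
    have hS' : ∀ x ∈ reflect L '' S, x < 2 ^ L := by
      rintro _ ⟨y, hy, rfl⟩
      have := hS y hy
      rw [reflect]
      split <;> omega
    -- If the top bit is that of `a`, folding `a`, `S` and the output preserves the error, because
    -- the reflection does not increase distances within `S` and `a`.
    by_cases hav : v L = decide (2 ^ L ≤ a)
    · have hra : reflect L a < 2 ^ L := by rw [reflect]; split <;> omega
      have key := ih hra hS' (by
        rintro _ ⟨y, hy, rfl⟩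
        have h1 := hs y hy
        have h2 := hS y hy
        rw [reflect, reflect]
        split <;> split <;> omega) (exists_mem_image_reflect h)
      rw [grayDecode, hav]
      rw [reflect] at key
      by_cases haL : 2 ^ L ≤ a
      · rw [if_neg (by omega)] at key
        rw [if_pos (by simpa using haL)]
        omega
      · rw [if_pos (by omega)] at key
        rw [if_neg (by simpa using haL)]
        omega
    -- Otherwise `a` and some `x` in `S` are separated by the midpoint, so `a` is within `s` of it
    -- and `S` within `2 s`. After folding, `S` sits at the upper end, where decoding errs by at
    -- most `4 s`; with the distance of `a` from the midpoint this makes `5 s`.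
    · obtain ⟨x, hx, hxv⟩ := exists_mem_top_bit h
      have hxa : ¬ (2 ^ L ≤ x ↔ 2 ^ L ≤ a) := fun hiff => hav (by rw [hxv]; simp [hiff])
      have h1 := hs x hx
      have key := le_grayDecode_add_of_forall_le (m := 2 * s) hS' (by
        rintro _ ⟨y, hy, rfl⟩
        have h2 := hs y hy
        have h3 := hS y hy
        rw [reflect]
        by_cases haL : 2 ^ L ≤ a <;> by_cases hxL : 2 ^ L ≤ x <;>
          simp only [haL, hxL, iff_true, not_true_eq_false, iff_false] at hxa <;>
          split <;> omega) (exists_mem_image_reflect h)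
      rw [grayDecode]
      by_cases haL : 2 ^ L ≤ a <;> by_cases hxL : 2 ^ L ≤ x <;>
        simp only [haL, hxL, iff_true, not_true_eq_false, iff_false] at hxa <;>
        split <;> omega

/-- The squared distance of natural numbers. -/
def sqDist (a b : ℕ) : ℕ := ((a : ℤ) - b).natAbs ^ 2

lemma sqDist_cast (a b : ℕ) : (sqDist a b : ℝ) = ((a : ℝ) - b) ^ 2 := by
  rw [sqDist, Nat.cast_pow, Nat.cast_natAbs, Int.cast_abs, sq_abs]
  push_cast
  rfl

lemma sqDist_lt_of_lt {L a b : ℕ} (ha : a < 2 ^ L) (hb : b < 2 ^ L) :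
    sqDist a b < 2 ^ (2 * L) := by
  rw [sqDist, mul_comm, pow_mul]
  exact Nat.pow_lt_pow_left (by omega) two_ne_zero

/-- Decoding bits that agree with every three-quarters majority approximates every one of the
numbers as well as a typical one of them does. -/
lemma mul_sqDist_grayDecode_le {n L : ℕ} (hn : 0 < n) {x : Fin n → ℕ} {v : ℕ → Bool}
    (hx : ∀ i, x i < 2 ^ L)
    (hv : ∀ l < L, ∀ b, 3 * n ≤ 4 * (Finset.univ.filter fun i => grayBit L l (x i) = b).card →
      v l = b) (i₀ : Fin n) :
    n * sqDist (grayDecode L v) (x i₀) ≤ 100 * ∑ i, sqDist (x i) (x i₀) := by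
  set Q := ∑ i, sqDist (x i) (x i₀) with hQ
  -- By Markov's inequality fewer than a quarter of the points are farther than `R` from `x i₀`.
  -- Integrality turns farther than `R` into at least `R + 1`, which makes the inequality strict.
  set R := Nat.sqrt (4 * Q / n) with hR
  have hR1 : n * R ^ 2 ≤ 4 * Q := by
    have h1 : R ^ 2 ≤ 4 * Q / n := Nat.sqrt_le' _
    calc n * R ^ 2 ≤ n * (4 * Q / n) := Nat.mul_le_mul_left _ h1
      _ ≤ 4 * Q := Nat.mul_div_le _ _
  have hR2 : 4 * Q < n * (R + 1) ^ 2 := by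
    have h1 : 4 * Q / n < (R + 1) ^ 2 := Nat.lt_succ_sqrt' _
    rw [mul_comm n]
    exact (Nat.div_lt_iff_lt_mul hn).1 h1
  set near := Finset.univ.filter fun i => sqDist (x i) (x i₀) ≤ R ^ 2
  set far := Finset.univ.filter fun i => ¬ sqDist (x i) (x i₀) ≤ R ^ 2
  have hcard : near.card + far.card = n := by
    rw [Finset.card_filter_add_card_filter_not, Finset.card_univ, Fintype.card_fin]
  have hfar : far.card * (R + 1) ^ 2 ≤ Q := by
    calc far.card * (R + 1) ^ 2 = ∑ i ∈ far, (R + 1) ^ 2 := by rw [Finset.sum_const, smul_eq_mul]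
      _ ≤ ∑ i ∈ far, sqDist (x i) (x i₀) := by
        refine Finset.sum_le_sum fun i hi => ?_
        have h1 : R ^ 2 < sqDist (x i) (x i₀) := not_le.1 (Finset.mem_filter.1 hi).2
        rw [sqDist] at h1 ⊢
        exact Nat.pow_le_pow_left (lt_of_pow_lt_pow_left₀ 2 (Nat.zero_le _) h1) 2
      _ ≤ Q := Finset.sum_le_sum_of_subset (Finset.subset_univ _)
  have hfar4 : 4 * far.card < n := by
    by_contra hcon
    have h2 : n * (R + 1) ^ 2 ≤ 4 * far.card * (R + 1) ^ 2 :=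
      Nat.mul_le_mul_right _ (not_lt.1 hcon)
    rw [mul_assoc] at h2
    omega
  have hdec := grayDecode_near (S := x '' near) (s := R) (v := v) (hx i₀)
    (by rintro _ ⟨i, -, rfl⟩; exact hx i)
    (by
      rintro _ ⟨i, hi, rfl⟩
      have h1 : sqDist (x i) (x i₀) ≤ R ^ 2 := (Finset.mem_filter.1 hi).2
      rw [sqDist] at h1
      have h2 := (Nat.pow_le_pow_iff_left two_ne_zero).1 h1
      omega)
    (by
      intro l hl
      by_contra hcon
      push Not at hcon
      -- A bit that occurs at no near point is contradicted by more than three quarters of all the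
      -- points, so the majority rule would have flipped it.
      have hb : v l = !v l := by
        refine hv l hl _ ?_
        have hsub : near ⊆ Finset.univ.filter fun i => grayBit L l (x i) = !v l := by
          intro i hi
          have := hcon _ (Set.mem_image_of_mem x (Finset.mem_coe.2 hi))
          exact Finset.mem_filter.2 ⟨Finset.mem_univ i, Bool.eq_not_of_ne this⟩
        have := Finset.card_le_card hsub
        omega
      simp at hb)
  have hd : sqDist (grayDecode L v) (x i₀) ≤ (5 * R) ^ 2 := by
    rw [sqDist]
    exact Nat.pow_le_pow_left (by omega) 2
  calc n * sqDist (grayDecode L v) (x i₀) ≤ n * (5 * R) ^ 2 := Nat.mul_le_mul_left _ hd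
    _ = 25 * (n * R ^ 2) := by ring
    _ ≤ 100 * Q := by omega

/-! ### The protocol -/

/-- The squared Euclidean distance of integral points. -/
def sqDistVec {d : ℕ} (c x : Fin d → ℕ) : ℕ := ∑ j, sqDist (c j) (x j)

/-- The coordinates of a datum as natural numbers. -/
def Datum.val {d u : ℕ} (x : Datum d u) : Fin d → ℕ := fun j => x j

/-- A point with natural coordinates as a point of Euclidean space. -/
noncomputable def natPoint {d : ℕ} (c : Fin d → ℕ) : EuclideanSpace ℝ (Fin d) :=
  WithLp.toLp 2 fun j => (c j : ℝ)

lemma natPoint_val {d u : ℕ} (x : Datum d u) : natPoint x.val = x.toPoint := rfl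

lemma sqDistVec_cast {d : ℕ} (c x : Fin d → ℕ) :
    (sqDistVec c x : ℝ) = ‖natPoint c - natPoint x‖ ^ 2 := by
  rw [EuclideanSpace.norm_sq_eq, sqDistVec, Nat.cast_sum]
  refine Finset.sum_congr rfl fun j _ => ?_
  rw [sqDist_cast, Real.norm_eq_abs, sq_abs]
  rfl

/-- The coordinates of a message: bits of the coordinates of the datum, levels of the distance to
the center, and coordinates of the difference from the center. -/
abbrev Slot (d L K : ℕ) : Type := (Fin d × Fin L) ⊕ (Fin K ⊕ Fin d)

section

variable {n d u : ℕ} (L K : ℕ) (s : ℝ)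

/-- The scaled signs given by the reflected binary codes of the coordinates. -/
noncomputable def codeMsg (x : Datum d u) (p : Fin d × Fin L) : ℝ :=
  s / √(d * L : ℕ) * if grayBit L p.2 (x.val p.1) then 1 else -1

/-- The scaled indicators of the event that the squared distance to `c` is at least `2 ^ k`. -/
noncomputable def levelMsg (c : Fin d → ℕ) (x : Datum d u) (k : Fin K) : ℝ :=
  s / √K * if 2 ^ (k : ℕ) ≤ sqDistVec c x.val then 1 else 0

/-- The scaled difference from `c`, or `0` if its square is at least `2 ^ k`. -/
noncomputable def shiftMsg (c : Fin d → ℕ) (k : ℕ) (x : Datum d u) (j : Fin d) : ℝ :=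
  if sqDistVec c x.val < 2 ^ k then s * (((x.val j : ℝ) - c j) / √(2 ^ k - 1)) else 0

/-- Which slots of the sum of the messages exceed their threshold. -/
noncomputable def exceeds {ι : Type} (θ : ι → ℝ) (m : Fin n → ι → ℝ) (k : ι) : Bool :=
  open Classical in decide (θ k < ∑ i, m i k)

variable {L K} in
/-- The center that is decoded from the votes on the bits. -/
def center (b : Slot d L K → Bool) (j : Fin d) : ℕ :=
  grayDecode L fun l => if h : l < L then b (Sum.inl (j, ⟨l, h⟩)) else false

variable {L K} in
/-- The first level that is not exceeded. -/
noncomputable def level (b : Slot d L K → Bool) : ℕ :=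
  sInf {k | ∀ h : k < K, b (Sum.inr (Sum.inl ⟨k, h⟩)) = false}

/-- The noiseless message of the second round. -/
noncomputable def levelSlot (b : Slot d L K → Bool) (x : Datum d u) : Slot d L K → ℝ :=
  Sum.elim 0 (Sum.elim (levelMsg K s (center b) x) 0)

/-- The noiseless message of the third round. -/
noncomputable def shiftSlot (b₁ b₂ : Slot d L K → Bool) (x : Datum d u) : Slot d L K → ℝ :=
  Sum.elim 0 (Sum.elim 0 (shiftMsg s (center b₁) (level b₂) x))

/-- The noiseless messages. -/
noncomputable def meanMsg (θ : Slot d L K → ℝ) :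
    ∀ t, History n (Slot d L K → ℝ) t → Datum d u → Slot d L K → ℝ
  | 0, _, x => Sum.elim (codeMsg L s x) 0
  | 1, ⟨_, m₁⟩, x => levelSlot L K s (exceeds θ m₁) x
  | 2, ⟨⟨_, m₁⟩, m₂⟩, x => shiftSlot L K s (exceeds θ m₁) (exceeds θ m₂) x
  | _ + 3, _, _ => 0

/-- The estimate from the bits of the first two rounds and the messages of the third round. -/
noncomputable def estimateFrom (b₁ b₂ : Slot d L K → Bool) (m₃ : Fin n → Slot d L K → ℝ) :
    EuclideanSpace ℝ (Fin d) :=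
  WithLp.toLp 2 fun j =>
    (center b₁ j : ℝ) + √(2 ^ level b₂ - 1) / (s * n) * ∑ i, m₃ i (Sum.inr (Sum.inr j))

/-- The estimate. -/
noncomputable def estimate (θ : Slot d L K → ℝ) :
    History n (Slot d L K → ℝ) 3 → EuclideanSpace ℝ (Fin d)
  | ⟨⟨⟨_, m₁⟩, m₂⟩, m₃⟩ => estimateFrom L K s (exceeds θ m₁) (exceeds θ m₂) m₃

/-! ### Measurability -/

lemma measurable_exceeds {ι : Type} (θ : ι → ℝ) :
    Measurable (exceeds θ : (Fin n → ι → ℝ) → ι → Bool) := by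
  classical
  refine measurable_pi_lambda _ fun k => ?_
  have h : Measurable fun m : Fin n → ι → ℝ => ∑ i, m i k :=
    Finset.measurable_sum _ fun i _ => (measurable_pi_apply k).comp (measurable_pi_apply i)
  refine measurable_to_bool ?_
  have : (fun m => exceeds θ m k) ⁻¹' {true} = {m : Fin n → ι → ℝ | θ k < ∑ i, m i k} := by
    ext m
    simp [exceeds]
  rw [this]
  exact measurableSet_lt measurable_const h

lemma measurable_codeMsg_slot : Measurable fun x : Datum d u =>
    (Sum.elim (codeMsg L s x) 0 : Slot d L K → ℝ) := measurable_of_countable _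

/-- The history enters only through finitely many threshold bits, so once `exceeds` is known to be
measurable, the remaining map has a countable domain. -/
lemma measurable_levelSlot {H : Type} [MeasurableSpace H] (θ : Slot d L K → ℝ) :
    Measurable fun p : (H × (Fin n → Slot d L K → ℝ)) × Datum d u =>
      levelSlot L K s (exceeds θ p.1.2) p.2 := by
  have hm : Measurable fun q : (Slot d L K → Bool) × Datum d u => levelSlot L K s q.1 q.2 :=
    measurable_of_countable _
  have h : Measurable fun p : (H × (Fin n → Slot d L K → ℝ)) × Datum d u =>
      (exceeds θ p.1.2, p.2) :=
    ((measurable_exceeds θ).comp (measurable_snd.comp measurable_fst)).prodMk measurable_snd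
  simpa only [Function.comp_def] using hm.comp h

lemma measurable_shiftSlot {H : Type} [MeasurableSpace H] (θ : Slot d L K → ℝ) :
    Measurable fun p : ((H × (Fin n → Slot d L K → ℝ)) × (Fin n → Slot d L K → ℝ)) × Datum d u =>
      shiftSlot L K s (exceeds θ p.1.1.2) (exceeds θ p.1.2) p.2 := by
  have hm : Measurable fun q : ((Slot d L K → Bool) × (Slot d L K → Bool)) × Datum d u =>
      shiftSlot L K s q.1.1 q.1.2 q.2 := measurable_of_countable _
  have h : Measurable fun p : ((H × (Fin n → Slot d L K → ℝ)) ×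
      (Fin n → Slot d L K → ℝ)) × Datum d u => ((exceeds θ p.1.1.2, exceeds θ p.1.2), p.2) :=
    (((measurable_exceeds θ).comp
      (measurable_snd.comp (measurable_fst.comp measurable_fst))).prodMk
      ((measurable_exceeds θ).comp (measurable_snd.comp measurable_fst))).prodMk measurable_snd
  simpa only [Function.comp_def] using hm.comp h

lemma measurable_meanMsg (θ : Slot d L K → ℝ) (t : ℕ) :
    Measurable fun p : History n (Slot d L K → ℝ) t × Datum d u =>
      meanMsg L K s θ t p.1 p.2 := by
  match t with
  | 0 => exact (measurable_codeMsg_slot L K s).comp measurable_snd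
  | 1 => exact measurable_levelSlot (H := History n (Slot d L K → ℝ) 0) L K s θ
  | 2 => exact measurable_shiftSlot (H := History n (Slot d L K → ℝ) 0) L K s θ
  | _ + 3 => exact measurable_const

lemma measurable_estimateFrom {H : Type} [MeasurableSpace H] (θ : Slot d L K → ℝ) :
    Measurable fun p : ((H × (Fin n → Slot d L K → ℝ)) × (Fin n → Slot d L K → ℝ)) ×
        (Fin n → Slot d L K → ℝ) =>
      estimateFrom L K s (exceeds θ p.1.1.2) (exceeds θ p.1.2) p.2 := by
  refine (WithLp.measurable_toLp 2 _).comp (measurable_pi_lambda _ fun j => ?_)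
  have hc : Measurable fun b : Slot d L K → Bool => (center b j : ℝ) := measurable_of_countable _
  have hl : Measurable fun b : Slot d L K → Bool => √(2 ^ level b - 1) / (s * n) :=
    measurable_of_countable _
  have h1 : Measurable fun p : ((H × (Fin n → Slot d L K → ℝ)) × (Fin n → Slot d L K → ℝ)) ×
      (Fin n → Slot d L K → ℝ) => exceeds θ p.1.1.2 :=
    (measurable_exceeds θ).comp (measurable_snd.comp (measurable_fst.comp measurable_fst))
  have h2 : Measurable fun p : ((H × (Fin n → Slot d L K → ℝ)) × (Fin n → Slot d L K → ℝ)) ×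
      (Fin n → Slot d L K → ℝ) => exceeds θ p.1.2 :=
    (measurable_exceeds θ).comp (measurable_snd.comp measurable_fst)
  have h3 : Measurable fun p : ((H × (Fin n → Slot d L K → ℝ)) × (Fin n → Slot d L K → ℝ)) ×
      (Fin n → Slot d L K → ℝ) => ∑ i, p.2 i (Sum.inr (Sum.inr j)) :=
    Finset.measurable_sum _ fun i _ =>
      (measurable_pi_apply _).comp ((measurable_pi_apply i).comp measurable_snd)
  exact (hc.comp h1).add ((hl.comp h2).mul h3)

lemma measurable_estimate (θ : Slot d L K → ℝ) :
    Measurable (estimate L K s θ : History n (Slot d L K → ℝ) 3 → _) :=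
  measurable_estimateFrom (H := History n (Slot d L K → ℝ) 0) L K s θ

/-! ### Sensitivity -/

lemma sum_sq_le_of_abs_le {κ : Type*} [Fintype κ] {m : ℕ} (hm : Fintype.card κ = m) {s : ℝ}
    {f : κ → ℝ} {e : κ → ℝ} (he : ∀ k, e k ^ 2 ≤ 1) (hf : ∀ k, f k = s / √m * e k) :
    ∑ k, f k ^ 2 ≤ s ^ 2 := by
  rcases Nat.eq_zero_or_pos m with h0 | hpos
  · have : IsEmpty κ := Fintype.card_eq_zero_iff.1 (hm.trans h0)
    simp [sq_nonneg]
  · have hm' : (0 : ℝ) < m := by exact_mod_cast hpos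
    calc ∑ k, f k ^ 2 ≤ ∑ _k : κ, s ^ 2 / m := by
          refine Finset.sum_le_sum fun k _ => ?_
          rw [hf, mul_pow, div_pow, Real.sq_sqrt hm'.le]
          exact mul_le_of_le_one_right (by positivity) (he k)
      _ = s ^ 2 := by
          rw [Finset.sum_const, Finset.card_univ, hm, nsmul_eq_mul]
          field_simp

lemma sum_codeMsg_sq_le (x : Datum d u) : ∑ p, codeMsg L s x p ^ 2 ≤ s ^ 2 :=
  sum_sq_le_of_abs_le (m := d * L) (by simp)
    (e := fun p => if grayBit L p.2 (x.val p.1) then 1 else -1)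
    (fun p => by split <;> norm_num) fun p => rfl

lemma sum_levelMsg_sq_le (c : Fin d → ℕ) (x : Datum d u) : ∑ k, levelMsg K s c x k ^ 2 ≤ s ^ 2 :=
  sum_sq_le_of_abs_le (m := K) (by simp)
    (e := fun k : Fin K => if 2 ^ (k : ℕ) ≤ sqDistVec c x.val then 1 else 0)
    (fun p => by split <;> norm_num) fun p => rfl

/-- Squared distances are integers, so being below `2 ^ k` means being at most `2 ^ k - 1`. At `k =
0` the scale is zero and the message vanishes by the convention for division by zero. -/
lemma sum_shiftMsg_sq_le (c : Fin d → ℕ) (k : ℕ) (x : Datum d u) :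
    ∑ j, shiftMsg s c k x j ^ 2 ≤ s ^ 2 := by
  by_cases h : sqDistVec c x.val < 2 ^ k
  · have h1 : (sqDistVec c x.val : ℝ) ≤ 2 ^ k - 1 := by
      have : (sqDistVec c x.val : ℝ) + 1 ≤ 2 ^ k := by exact_mod_cast h
      linarith
    have h0 : (0 : ℝ) ≤ 2 ^ k - 1 := (Nat.cast_nonneg _).trans h1
    have h2 : ∀ j, shiftMsg s c k x j ^ 2 = s ^ 2 * (sqDist (c j) (x.val j) / (2 ^ k - 1)) := by
      intro j
      rw [shiftMsg, if_pos h, mul_pow, div_pow, Real.sq_sqrt h0, sqDist_cast]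
      ring
    simp_rw [h2]
    rw [← Finset.mul_sum, ← Finset.sum_div, ← Nat.cast_sum]
    exact mul_le_of_le_one_right (sq_nonneg s) (div_le_one_of_le₀ h1 h0)
  · simp [shiftMsg, h, sq_nonneg]

lemma sum_meanMsg_sq_le (θ : Slot d L K → ℝ) (t : ℕ) (h : History n (Slot d L K → ℝ) t)
    (x : Datum d u) : ∑ k, meanMsg L K s θ t h x k ^ 2 ≤ s ^ 2 := by
  match t, h with
  | 0, _ =>
    rw [Fintype.sum_sum_type]
    simpa [meanMsg] using sum_codeMsg_sq_le L s x
  | 1, ⟨_, m₁⟩ =>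
    rw [Fintype.sum_sum_type, Fintype.sum_sum_type]
    simpa [meanMsg, levelSlot] using sum_levelMsg_sq_le K s (center (exceeds θ m₁)) x
  | 2, ⟨⟨_, m₁⟩, m₂⟩ =>
    rw [Fintype.sum_sum_type, Fintype.sum_sum_type]
    simpa [meanMsg, shiftSlot] using sum_shiftMsg_sq_le s (center (exceeds θ m₁)) (level (exceeds θ m₂)) x
  | _ + 3, _ => simp [meanMsg, sq_nonneg]

end

/-! ### Accuracy when the noise is bounded -/

section

variable {n d u : ℕ} (L K : ℕ) {s : ℝ} {θ : Slot d L K → ℝ} {D : Fin n → Datum d u}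

lemma sum_ite_one_neg_one (f : Fin n → Bool) :
    ∑ i, (if f i then (1 : ℝ) else -1) =
      (Finset.univ.filter fun i => f i = true).card -
        (Finset.univ.filter fun i => f i = false).card := by
  rw [Finset.sum_ite, Finset.sum_const, Finset.sum_const]
  simp only [nsmul_eq_mul, mul_one, mul_neg, Bool.not_eq_true]
  ring

lemma card_filter_true_add_card_filter_false (f : Fin n → Bool) :
    (Finset.univ.filter fun i => f i = true).card +
      (Finset.univ.filter fun i => f i = false).card = n := by
  have := Finset.card_filter_add_card_filter_not (s := (Finset.univ : Finset (Fin n)))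
    fun i => f i = true
  simpa only [Bool.not_eq_true, Finset.card_univ, Fintype.card_fin] using this

/-- The decoded center is close to every datum, compared to the other data. -/
lemma mul_sqDistVec_center_le (hn : 0 < n) (hs : 0 < s) (hu : u < 2 ^ L)
    (hθ : ∀ p, θ (Sum.inl p) = 0) {m₁ : Fin n → Slot d L K → ℝ} {B₁ : ℝ}
    (hN : ∀ p, |∑ i, (m₁ i (Sum.inl p) - codeMsg L s (D i) p)| ≤ B₁)
    (hB : B₁ < s / √(d * L : ℕ) * (n / 2)) (i₀ : Fin n) :
    n * sqDistVec (center (exceeds θ m₁)) (D i₀).val ≤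
      100 * ∑ i, sqDistVec (D i).val (D i₀).val := by
  simp only [sqDistVec]
  -- The claim is linear in squared distances, so it splits into one claim per coordinate without
  -- loss in `d`.
  rw [Finset.sum_comm, Finset.mul_sum, Finset.mul_sum]
  refine Finset.sum_le_sum fun j _ => ?_
  refine mul_sqDist_grayDecode_le (x := fun i => (D i).val j) hn
    (fun i => (Nat.lt_succ_iff.1 (D i j).2).trans_lt hu) (fun l hl b hb => ?_) i₀
  rw [dif_pos hl]
  set f : Fin n → Bool := fun i => grayBit L l ((D i).val j) with hf
  have ha : 0 ≤ s / √(d * L : ℕ) := by positivity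
  have hsum : ∑ i, codeMsg L s (D i) (j, ⟨l, hl⟩) = s / √(d * L : ℕ) *
      ((Finset.univ.filter fun i => f i = true).card -
        (Finset.univ.filter fun i => f i = false).card) := by
    rw [← sum_ite_one_neg_one, Finset.mul_sum]
    rfl
  have hNp := abs_le.1 (hN (j, ⟨l, hl⟩))
  rw [Finset.sum_sub_distrib, hsum] at hNp
  have hc : (((Finset.univ.filter fun i => f i = true).card : ℕ) : ℝ) +
      ((Finset.univ.filter fun i => f i = false).card : ℕ) = n := by
    exact_mod_cast card_filter_true_add_card_filter_false f
  cases b with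
  | true =>
    have hb' : 3 * (n : ℝ) ≤ 4 * ((Finset.univ.filter fun i => f i = true).card : ℕ) := by
      exact_mod_cast hb
    -- A three-quarters majority leads by at least `n / 2` votes, more than the noise can offset.
    have : s / √(d * L : ℕ) * (n / 2) ≤ s / √(d * L : ℕ) *
      ((Finset.univ.filter fun i => f i = true).card -
        (Finset.univ.filter fun i => f i = false).card) :=
      mul_le_mul_of_nonneg_left (by linarith) ha
    rw [exceeds, hθ, decide_eq_true_eq]
    linarith
  | false =>
    have hb' : 3 * (n : ℝ) ≤ 4 * ((Finset.univ.filter fun i => f i = false).card : ℕ) := by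
      exact_mod_cast hb
    have : s / √(d * L : ℕ) * (n / 2) ≤ s / √(d * L : ℕ) *
      ((Finset.univ.filter fun i => f i = false).card -
        (Finset.univ.filter fun i => f i = true).card) :=
      mul_le_mul_of_nonneg_left (by linarith) ha
    rw [exceeds, hθ, decide_eq_false_iff_not]
    linarith

lemma center_lt (b : Slot d L K → Bool) (j : Fin d) : center b j < 2 ^ L := grayDecode_lt _ _

/-- This fixes the number of levels: beyond the last one no datum is left to drop. -/
lemma sqDistVec_lt (hu : u < 2 ^ L) {c : Fin d → ℕ} (hc : ∀ j, c j < 2 ^ L) (x : Datum d u) :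
    sqDistVec c x.val < 2 ^ (d.size + 2 * L) := by
  calc sqDistVec c x.val ≤ ∑ _j : Fin d, 2 ^ (2 * L) :=
        Finset.sum_le_sum fun j _ =>
          (sqDist_lt_of_lt (hc j) ((Nat.lt_succ_iff.1 (x j).2).trans_lt hu)).le
    _ = d * 2 ^ (2 * L) := by simp
    _ < 2 ^ d.size * 2 ^ (2 * L) := by
        gcongr
        exact Nat.lt_size_self d
    _ = 2 ^ (d.size + 2 * L) := (pow_add _ _ _).symm

variable {L K}

lemma level_spec (b : Slot d L K → Bool) (h : level b < K) :
    b (Sum.inr (Sum.inl ⟨level b, h⟩)) = false := by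
  have hne : {k | ∀ h : k < K, b (Sum.inr (Sum.inl ⟨k, h⟩)) = false}.Nonempty :=
    ⟨K, fun h => absurd h (lt_irrefl K)⟩
  exact Nat.sInf_mem hne h

lemma exists_of_lt_level {b : Slot d L K → Bool} {k : ℕ} (hk : k < level b) :
    ∃ h : k < K, b (Sum.inr (Sum.inl ⟨k, h⟩)) = true := by
  have : ¬ ∀ h : k < K, b (Sum.inr (Sum.inl ⟨k, h⟩)) = false := Nat.notMem_of_lt_sInf hk
  push Not at this
  obtain ⟨h, hb⟩ := this
  exact ⟨h, by simpa using hb⟩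

lemma sum_levelMsg (s : ℝ) (D : Fin n → Datum d u) (c : Fin d → ℕ) (k : Fin K) :
    ∑ i, levelMsg K s c (D i) k =
      s / √K * (Finset.univ.filter fun i => 2 ^ (k : ℕ) ≤ sqDistVec c (D i).val).card := by
  simp only [levelMsg]
  rw [← Finset.mul_sum, Finset.sum_boole]

section

variable {c : Fin d → ℕ} {m₂ : Fin n → Slot d L K → ℝ} {B₂ : ℝ}
    (hθ : ∀ k, θ (Sum.inr (Sum.inl k)) = B₂)
    (hN : ∀ k, |∑ i, (m₂ i (Sum.inr (Sum.inl k)) - levelMsg K s c (D i) k)| ≤ B₂)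

include hθ hN

/-- The chosen level is not exceeded, so its noisy count is at most the threshold `B₂`, and the
noise can hide at most another `B₂`. If every level is exceeded, `hK` shows that nobody is dropped.
-/
lemma card_level_le (hB : 0 ≤ B₂) (hK : ∀ i, sqDistVec c (D i).val < 2 ^ K) :
    s / √K * (Finset.univ.filter fun i =>
      2 ^ level (exceeds θ m₂) ≤ sqDistVec c (D i).val).card ≤ 2 * B₂ := by
  by_cases h : level (exceeds θ m₂) < K
  · have h1 := level_spec _ h
    rw [exceeds, decide_eq_false_iff_not, hθ, not_lt] at h1
    have h2 := (abs_le.1 (hN ⟨_, h⟩)).1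
    rw [Finset.sum_sub_distrib, sum_levelMsg] at h2
    linarith
  · have : (Finset.univ.filter fun i =>
        2 ^ level (exceeds θ m₂) ≤ sqDistVec c (D i).val) = ∅ := by
      refine Finset.filter_eq_empty_iff.2 fun i _ => not_le.2 ((hK i).trans_le ?_)
      exact Nat.pow_le_pow_right two_pos (not_lt.1 h)
    rw [this]
    simpa using hB

/-- The threshold equals the noise bound, so noise alone can never exceed it. -/
lemma exists_pow_le_of_lt_level {k : ℕ} (hk : k < level (exceeds θ m₂)) :
    ∃ i, 2 ^ k ≤ sqDistVec c (D i).val := by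
  obtain ⟨h, hb⟩ := exists_of_lt_level hk
  rw [exceeds, decide_eq_true_eq, hθ] at hb
  have h2 := (abs_le.1 (hN ⟨k, h⟩)).2
  rw [Finset.sum_sub_distrib, sum_levelMsg] at h2
  by_contra hcon
  push Not at hcon
  have : (Finset.univ.filter fun i => 2 ^ k ≤ sqDistVec c (D i).val) = ∅ :=
    Finset.filter_eq_empty_iff.2 fun i _ => not_le.2 (hcon i)
  simp only [this, Finset.card_empty, Nat.cast_zero, mul_zero, sub_zero] at h2
  linarith

/-- The level just below the chosen one is attained by a datum, and doubling it costs the factor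
`√2`. Subtracting 1 makes the radius exactly zero at level 0, so that the noise disappears when all
data coincide. -/
lemma sqrt_two_pow_level_le {A : ℝ} (hA : 0 ≤ A)
    (hc : ∀ i, ‖natPoint c - (D i).toPoint‖ ≤ A) :
    √(2 ^ level (exceeds θ m₂) - 1) ≤ √2 * A := by
  rcases Nat.eq_zero_or_pos (level (exceeds θ m₂)) with h0 | hpos
  · rw [h0]
    simp only [pow_zero, sub_self, Real.sqrt_zero]
    positivity
  · obtain ⟨i, hi⟩ := exists_pow_le_of_lt_level hθ hN (Nat.sub_lt hpos one_pos)
    have h1 : (2 : ℝ) ^ (level (exceeds θ m₂) - 1) ≤ A ^ 2 := by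
      calc (2 : ℝ) ^ (level (exceeds θ m₂) - 1) ≤ sqDistVec c (D i).val := by exact_mod_cast hi
        _ = ‖natPoint c - (D i).toPoint‖ ^ 2 := sqDistVec_cast _ _
        _ ≤ A ^ 2 := pow_le_pow_left₀ (norm_nonneg _) (hc i) 2
    have h2 : (2 : ℝ) ^ level (exceeds θ m₂) = 2 * 2 ^ (level (exceeds θ m₂) - 1) := by
      rw [← pow_succ', Nat.sub_add_cancel hpos]
    rw [← Real.sqrt_sq hA, ← Real.sqrt_mul zero_le_two]
    exact Real.sqrt_le_sqrt (by linarith)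

end

/-- The error of the estimate, given bounds for the distance of the data from the center, for the
number of data that are dropped, and for the noise. -/
lemma norm_estimateFrom_sub_mean_le (hn : 0 < n) (hs : 0 < s) {b₁ b₂ : Slot d L K → Bool}
    {m₃ : Fin n → Slot d L K → ℝ} {A M R B₃ : ℝ} (hA : 0 ≤ A) (hB : 0 ≤ B₃)
    (hc : ∀ i, ‖natPoint (center b₁) - (D i).toPoint‖ ≤ A)
    (hM : ((Finset.univ.filter fun i =>
      2 ^ level b₂ ≤ sqDistVec (center b₁) (D i).val).card : ℝ) ≤ M)
    (hR : √(2 ^ level b₂ - 1) ≤ R)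
    (hN : ∀ j, |∑ i, (m₃ i (Sum.inr (Sum.inr j)) -
      shiftMsg s (center b₁) (level b₂) (D i) j)| ≤ B₃) :
    ‖estimateFrom L K s b₁ b₂ m₃ - mean D‖ ≤ (M * A + R / s * (√d * B₃)) / n := by
  have hn' : (0 : ℝ) < n := by exact_mod_cast hn
  set c := center b₁
  set k := level b₂
  set r := √((2 : ℝ) ^ k - 1)
  -- The bias of a dropped user, whose zero message makes the estimator count the center in place of
  -- the datum.
  set e : Fin n → EuclideanSpace ℝ (Fin d) := fun i =>
    if 2 ^ k ≤ sqDistVec c (D i).val then natPoint c - (D i).toPoint else 0 with he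
  set Z : EuclideanSpace ℝ (Fin d) := WithLp.toLp 2 fun j =>
    ∑ i, (m₃ i (Sum.inr (Sum.inr j)) - shiftMsg s c k (D i) j) with hZ
  have hpt : ∀ i j, e i j + (D i).toPoint j = c j + r / s * shiftMsg s c k (D i) j := by
    intro i j
    by_cases h : 2 ^ k ≤ sqDistVec c (D i).val
    · rw [he, shiftMsg, if_neg (not_lt.2 h)]
      simp only [if_pos h, PiLp.sub_apply, sub_add_cancel, mul_zero, add_zero]
      rfl
    · rw [he, shiftMsg, if_pos (not_le.1 h)]
      simp only [if_neg h, PiLp.zero_apply, zero_add]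
      have hx : (D i).toPoint j = ((D i).val j : ℝ) := rfl
      rw [hx]
      -- With radius zero, a datum that is kept is at squared distance zero and coincides with the
      -- center.
      by_cases hr : r = 0
      · have h0 : sqDistVec c (D i).val = 0 := by
          have h1 : (2 : ℝ) ^ k - 1 ≤ 0 := Real.sqrt_eq_zero'.1 hr
          have h2 : ((sqDistVec c (D i).val : ℕ) : ℝ) + 1 ≤ 2 ^ k := by exact_mod_cast not_le.1 h
          have h3 : ((sqDistVec c (D i).val : ℕ) : ℝ) ≤ 0 := by linarith
          exact_mod_cast le_antisymm h3 (Nat.cast_nonneg _)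
        have h4 : sqDist (c j) ((D i).val j) = 0 :=
          (Finset.sum_eq_zero_iff.1 h0) j (Finset.mem_univ j)
        have h5 : ((c j : ℝ) - (D i).val j) ^ 2 = 0 := by rw [← sqDist_cast, h4, Nat.cast_zero]
        have h6 := pow_eq_zero_iff two_ne_zero |>.1 h5
        rw [hr, zero_div, zero_mul, add_zero]
        linarith
      · change ((D i).val j : ℝ) = c j + r / s * (s * (((D i).val j - c j) / r))
        field_simp
        ring
  have hdecomp : estimateFrom L K s b₁ b₂ m₃ - mean D =
      (n : ℝ)⁻¹ • (∑ i, e i + (r / s) • Z) := by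
    ext j
    have h1 : ∑ i, e i j = ∑ i, (c j + r / s * shiftMsg s c k (D i) j - (D i).toPoint j) :=
      Finset.sum_congr rfl fun i _ => by rw [← hpt]; ring
    simp only [estimateFrom, mean, hZ, PiLp.sub_apply, PiLp.smul_apply, PiLp.add_apply,
      WithLp.ofLp_sum, Finset.sum_apply, smul_eq_mul]
    rw [h1, Finset.sum_sub_distrib, Finset.sum_sub_distrib, Finset.sum_add_distrib,
      Finset.sum_const, Finset.card_univ, Fintype.card_fin, nsmul_eq_mul, ← Finset.mul_sum]
    field_simp
    ring
  have hZn : ‖Z‖ ≤ √d * B₃ := by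
    rw [EuclideanSpace.norm_eq, ← Real.sqrt_sq hB, ← Real.sqrt_mul (Nat.cast_nonneg d)]
    refine Real.sqrt_le_sqrt ?_
    calc ∑ j, ‖Z j‖ ^ 2 ≤ ∑ _j : Fin d, B₃ ^ 2 :=
          Finset.sum_le_sum fun j _ => pow_le_pow_left₀ (norm_nonneg _) (hN j) 2
      _ = d * B₃ ^ 2 := by simp
  have hen : ‖∑ i, e i‖ ≤ M * A := by
    calc ‖∑ i, e i‖ ≤ ∑ i, ‖e i‖ := norm_sum_le _ _
      _ ≤ ∑ i, if 2 ^ k ≤ sqDistVec c (D i).val then A else 0 := by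
          refine Finset.sum_le_sum fun i _ => ?_
          rw [he]
          dsimp only
          split
          · exact hc i
          · simp
      _ = (Finset.univ.filter fun i => 2 ^ k ≤ sqDistVec c (D i).val).card * A := by
          rw [← Finset.sum_filter, Finset.sum_const, nsmul_eq_mul]
      _ ≤ M * A := mul_le_mul_of_nonneg_right hM hA
  have hr0 : 0 ≤ r / s := div_nonneg (Real.sqrt_nonneg _) hs.le
  rw [hdecomp, norm_smul, norm_inv, Real.norm_natCast, inv_mul_eq_div]
  refine div_le_div_of_nonneg_right ((norm_add_le _ _).trans (add_le_add hen ?_)) hn'.le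
  rw [norm_smul, Real.norm_of_nonneg hr0]
  exact mul_le_mul (div_le_div_of_nonneg_right hR hs.le) hZn (norm_nonneg _)
    (div_nonneg ((Real.sqrt_nonneg _).trans hR) hs.le)

lemma norm_toPoint_sub_le_width (D : Fin n → Datum d u) (i i' : Fin n) :
    ‖(D i).toPoint - (D i').toPoint‖ ≤ width D := by
  rw [← dist_eq_norm]
  exact Metric.dist_le_diam_of_mem (Set.finite_range _).isBounded ⟨i, rfl⟩ ⟨i', rfl⟩

/-- Every term of the average squared distance to the datum is at most `w²`; the 10 is the root of
100. -/
lemma norm_center_sub_le (hn : 0 < n) {c : Fin d → ℕ} {i₀ : Fin n}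
    (h : n * sqDistVec c (D i₀).val ≤ 100 * ∑ i, sqDistVec (D i).val (D i₀).val) :
    ‖natPoint c - (D i₀).toPoint‖ ≤ 10 * width D := by
  have hw : 0 ≤ width D := Metric.diam_nonneg
  have hn' : (0 : ℝ) < n := by exact_mod_cast hn
  have h1 : (n : ℝ) * ‖natPoint c - (D i₀).toPoint‖ ^ 2 ≤
      100 * ∑ i, ‖(D i).toPoint - (D i₀).toPoint‖ ^ 2 := by
    have h2 : (n : ℝ) * (sqDistVec c (D i₀).val : ℕ) ≤
        100 * ∑ i, ((sqDistVec (D i).val (D i₀).val : ℕ) : ℝ) := by exact_mod_cast h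
    simpa only [sqDistVec_cast, natPoint_val] using h2
  have h3 : ∑ i, ‖(D i).toPoint - (D i₀).toPoint‖ ^ 2 ≤ n * width D ^ 2 := by
    calc ∑ i, ‖(D i).toPoint - (D i₀).toPoint‖ ^ 2 ≤ ∑ _i : Fin n, width D ^ 2 :=
          Finset.sum_le_sum fun i _ =>
            pow_le_pow_left₀ (norm_nonneg _) (norm_toPoint_sub_le_width D i i₀) 2
      _ = n * width D ^ 2 := by simp
  refine le_of_sq_le_sq ?_ (by positivity)
  refine le_of_mul_le_mul_left ?_ hn'
  calc (n : ℝ) * ‖natPoint c - (D i₀).toPoint‖ ^ 2 ≤ 100 * (n * width D ^ 2) :=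
        h1.trans (mul_le_mul_of_nonneg_left h3 (by norm_num))
    _ = n * (10 * width D) ^ 2 := by ring

end

/-! ### The choice of the parameters -/

/-- A bound for the noise in all of `m` slots. -/
noncomputable def noiseBound (n m : ℕ) (β : ℝ) : ℝ := √(2 * n * Real.log (18 * m / β))

/-- The `18 = 2 * 9` in `noiseBound` covers two tails and nine events: three families of slots in
each of three rounds. -/
lemma mul_two_exp_noiseBound_le {n : ℕ} (hn : 0 < n) (m : ℕ) {β : ℝ} (h0 : 0 < β) (h1 : β < 1) :
    m * (2 * Real.exp (-noiseBound n m β ^ 2 / (2 * n))) ≤ β / 9 := by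
  have hn' : (0 : ℝ) < n := by exact_mod_cast hn
  rcases Nat.eq_zero_or_pos m with rfl | hm
  · simp only [Nat.cast_zero, zero_mul]
    positivity
  · have hm' : (1 : ℝ) ≤ m := by exact_mod_cast hm
    have hx : 1 ≤ 18 * m / β := by
      rw [le_div_iff₀ h0]
      linarith
    rw [noiseBound, Real.sq_sqrt (mul_nonneg (by positivity) (Real.log_nonneg hx)), neg_div,
      mul_div_cancel_left₀ _ (by positivity), Real.exp_neg, Real.exp_log (by positivity)]
    apply le_of_eq
    field_simp
    norm_num

lemma size_le_one_add_log {m : ℕ} (hm : 0 < m) :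
    (m.size : ℝ) * Real.log 2 ≤ Real.log 2 + Real.log m := by
  obtain ⟨k, hk⟩ : ∃ k, m.size = k + 1 := ⟨m.size - 1, by have := Nat.size_pos.2 hm; omega⟩
  have h1 : 2 ^ k ≤ m := Nat.lt_size.1 (by omega)
  have h2 : (k : ℝ) * Real.log 2 ≤ Real.log m := by
    rw [← Real.log_pow]
    exact Real.log_le_log (by positivity) (by exact_mod_cast h1)
  rw [hk]
  push_cast
  linarith

lemma size_le_self {m : ℕ} : m.size ≤ m := Nat.size_le.2 Nat.lt_two_pow_self

lemma log_const_mul_div_le {a b β r : ℝ} (ha : 0 < a) (hb : 0 < b) (h0 : 0 < β) {m : ℝ}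
    (hm0 : 0 < m) (hm : m ≤ a * b) (hr : Real.log a ≤ r * Real.log (b / β)) :
    Real.log (m / β) ≤ (1 + r) * Real.log (b / β) := by
  calc Real.log (m / β) ≤ Real.log (a * (b / β)) := by
        refine Real.log_le_log (by positivity) ?_
        rw [← mul_div_assoc]
        exact div_le_div_of_nonneg_right hm h0.le
    _ = Real.log a + Real.log (b / β) := Real.log_mul ha.ne' (by positivity)
    _ ≤ (1 + r) * Real.log (b / β) := by linarith

lemma log_le_of_le_two_pow {a x : ℝ} {k : ℕ} (ha : 0 < a) (hak : a ≤ 2 ^ k)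
    (hx : Real.log 2 ≤ x) : Real.log a ≤ k * x := by
  calc Real.log a ≤ Real.log (2 ^ k) := Real.log_le_log ha hak
    _ = k * Real.log 2 := Real.log_pow _ _
    _ ≤ k * x := mul_le_mul_of_nonneg_left hx (Nat.cast_nonneg k)

section

variable {n d u : ℕ} {ρ β : ℝ}

lemma log_two_le_log_mul (hdu : 2 ≤ d * u) : Real.log 2 ≤ Real.log (d * u) :=
  Real.log_le_log two_pos (by exact_mod_cast hdu)

lemma log_mul_le_log_mul_div (hdu : 2 ≤ d * u) (h0 : 0 < β) (h1 : β < 1) :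
    Real.log (d * u) ≤ Real.log (d * u / β) := by
  have h : (0 : ℝ) < d * u := by exact_mod_cast (by omega : 0 < d * u)
  refine Real.log_le_log h ?_
  rw [le_div_iff₀ h0]
  nlinarith

lemma size_le_three_mul_log (hdu : 2 ≤ d * u) : (u.size : ℝ) ≤ 3 * Real.log (d * u) := by
  have hd : 0 < d := Nat.pos_of_ne_zero (by rintro rfl; omega)
  have hu : 0 < u := Nat.pos_of_ne_zero (by rintro rfl; omega)
  have hd' : (1 : ℝ) ≤ d := by exact_mod_cast hd
  have hu' : (0 : ℝ) < u := by exact_mod_cast hu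
  have h1 := size_le_one_add_log hu
  have h2 : Real.log u ≤ Real.log (d * u) := Real.log_le_log hu' (by nlinarith)
  have h3 := log_two_le_log_mul hdu
  have h4 := Real.log_two_gt_d9
  have h5 : (0 : ℝ) ≤ u.size := Nat.cast_nonneg _
  nlinarith

lemma levels_le_eight_mul_log (hdu : 2 ≤ d * u) :
    ((d.size + 2 * u.size : ℕ) : ℝ) ≤ 8 * Real.log (d * u) := by
  have hd : 0 < d := Nat.pos_of_ne_zero (by rintro rfl; omega)
  have hu : 0 < u := Nat.pos_of_ne_zero (by rintro rfl; omega)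
  have hd' : (1 : ℝ) ≤ d := by exact_mod_cast hd
  have hu' : (1 : ℝ) ≤ u := by exact_mod_cast hu
  have h1 := size_le_one_add_log hu
  have h1' := size_le_one_add_log hd
  have h2 : Real.log (d * u) = Real.log d + Real.log u :=
    Real.log_mul (by positivity) (by positivity)
  have h3 := log_two_le_log_mul hdu
  have h4 := Real.log_two_gt_d9
  have h5 : (0 : ℝ) ≤ u.size := Nat.cast_nonneg _
  have h6 : (0 : ℝ) ≤ d.size := Nat.cast_nonneg _
  have h7 := Real.log_nonneg hd'
  push_cast
  nlinarith

/-- The noise in the first round cannot change a three-quarters majority. -/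
lemma noiseBound_lt (hn : 1 ≤ n) (hdu : 2 ≤ d * u) (hρ : 0 < ρ) (h0 : 0 < β) (h1 : β < 1)
    (hc : 100 * (tau n d u ρ β * √(d : ℝ)) ≤ n) :
    noiseBound n (d * u.size) β < √(ρ / 6) / √(d * u.size : ℕ) * (n / 2) := by
  have hd : 0 < d := Nat.pos_of_ne_zero (by rintro rfl; omega)
  have hu : 0 < u := Nat.pos_of_ne_zero (by rintro rfl; omega)
  have hL : 0 < u.size := Nat.size_pos.2 hu
  have hd' : (0 : ℝ) < d := by exact_mod_cast hd
  have hu' : (0 : ℝ) < u := by exact_mod_cast hu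
  have hL' : (0 : ℝ) < u.size := by exact_mod_cast hL
  have hn' : (0 : ℝ) < n := by exact_mod_cast hn
  have hLl := size_le_three_mul_log hdu
  have h2 := log_two_le_log_mul hdu
  have h3 := log_mul_le_log_mul_div hdu h0 h1
  have h4 := Real.log_two_gt_d9
  have hlog : Real.log (18 * (d * u.size : ℕ) / β) ≤ 6 * Real.log (d * u / β) := by
    have hsz : (u.size : ℝ) ≤ u := by exact_mod_cast size_le_self
    have hr : Real.log 18 ≤ (5 : ℕ) * Real.log (d * u / β) :=
      log_le_of_le_two_pow (k := 5) (by norm_num) (by norm_num) (h2.trans h3)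
    have hlog := log_const_mul_div_le (a := 18) (b := (d : ℝ) * u) (β := β) (r := (5 : ℕ))
      (m := 18 * (d * u.size : ℕ)) (by norm_num) (by positivity) h0 (by positivity)
      (by push_cast; gcongr)
      hr
    push_cast at hlog ⊢
    linarith
  set l := Real.log (d * u) with hl
  set Λ := Real.log (d * u / β) with hΛ
  have hl0 : 0 < l := by linarith
  have hΛ0 : 0 < Λ := by linarith
  have hsq : 10000 * (l ^ 4 * Λ ^ 2 * d) ≤ n * ρ := by
    have h5 : (100 * (tau n d u ρ β * √(d : ℝ))) ^ 2 ≤ (n : ℝ) ^ 2 :=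
      pow_le_pow_left₀ (by unfold tau; positivity) hc 2
    have h6 : (100 * (tau n d u ρ β * √(d : ℝ))) ^ 2 =
        10000 * (l ^ 4 * Λ ^ 2 * d) * (n / ρ) := by
      rw [tau, mul_pow, mul_pow, mul_pow, mul_pow, Real.sq_sqrt (by positivity),
        Real.sq_sqrt hd'.le]
      ring
    rw [h6, mul_div_assoc', div_le_iff₀ hρ] at h5
    have h7 : (n : ℝ) * (10000 * (l ^ 4 * Λ ^ 2 * d)) ≤ n * (n * ρ) := by nlinarith
    exact le_of_mul_le_mul_left h7 hn'
  -- Both logarithms are at least `log 2 > 0.69`, so the surplus powers in `τ²` cost only a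
  -- constant.
  have hl3 : 0.2 ≤ l ^ 3 * Λ := by
    have h5 : (0.69 : ℝ) ≤ l := by linarith
    have h6 : (0.69 : ℝ) ≤ Λ := by linarith
    calc (0.2 : ℝ) ≤ 0.69 ^ 3 * 0.69 := by norm_num
      _ ≤ l ^ 3 * Λ := by gcongr
  have hmain : 864 * (d * l * Λ) < n * ρ := by
    have h5 : 0 < d * l * Λ := by positivity
    have h6 : 0.2 * (d * l * Λ) ≤ l ^ 4 * Λ ^ 2 * d := by
      calc 0.2 * (d * l * Λ) ≤ l ^ 3 * Λ * (d * l * Λ) := by gcongr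
        _ = l ^ 4 * Λ ^ 2 * d := by ring
    linarith
  rw [noiseBound, Real.sqrt_lt' (by positivity), mul_pow, div_pow, div_pow,
    Real.sq_sqrt (by positivity), Real.sq_sqrt (by positivity), Nat.cast_mul] at *
  rw [div_mul_eq_mul_div, lt_div_iff₀ (by positivity)]
  calc 2 * (n : ℝ) * Real.log (18 * (d * u.size : ℝ) / β) * (d * u.size)
      ≤ 2 * n * (6 * Λ) * (d * (3 * l)) := by gcongr
    _ = 36 * n * (d * l * Λ) := by ring
    _ < ρ / 6 * (n ^ 2 / 2 ^ 2) := by nlinarith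

/-- The number of data that are dropped in the third round is at most a multiple of `τ`. -/
lemma dropped_le (hdu : 2 ≤ d * u) (hρ : 0 < ρ) (h0 : 0 < β) (h1 : β < 1) :
    2 * noiseBound n (d.size + 2 * u.size) β / (√(ρ / 6) / √(d.size + 2 * u.size : ℕ)) ≤
      110 * tau n d u ρ β := by
  have hd : 0 < d := Nat.pos_of_ne_zero (by rintro rfl; omega)
  have hu : 0 < u := Nat.pos_of_ne_zero (by rintro rfl; omega)
  have hd' : (1 : ℝ) ≤ d := by exact_mod_cast hd
  have hu' : (1 : ℝ) ≤ u := by exact_mod_cast hu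
  have hKl := levels_le_eight_mul_log hdu
  have hKdu : ((d.size + 2 * u.size : ℕ) : ℝ) ≤ 3 * (d * u) := by
    have h5 : (u.size : ℝ) ≤ u := by exact_mod_cast size_le_self
    have h6 : (d.size : ℝ) ≤ d := by exact_mod_cast size_le_self
    push_cast
    nlinarith
  have hK0 : 0 < ((d.size + 2 * u.size : ℕ) : ℝ) := by
    exact_mod_cast Nat.add_pos_left (Nat.size_pos.2 hd) _
  have h2 := log_two_le_log_mul hdu
  have h3 := log_mul_le_log_mul_div hdu h0 h1
  have h4 := Real.log_two_gt_d9
  set K : ℝ := ((d.size + 2 * u.size : ℕ) : ℝ) with hK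
  have hlog : Real.log (18 * K / β) ≤ 7 * Real.log (d * u / β) := by
    have hr : Real.log 54 ≤ (6 : ℕ) * Real.log (d * u / β) :=
      log_le_of_le_two_pow (k := 6) (by norm_num) (by norm_num) (h2.trans h3)
    have hlog := log_const_mul_div_le (a := 54) (b := d * u) (β := β) (r := (6 : ℕ))
      (m := 18 * K) (by norm_num) (by positivity) h0 (by positivity) (by linarith)
      hr
    push_cast at hlog ⊢
    linarith
  rw [tau]
  set l := Real.log (d * u) with hl
  set Λ := Real.log (d * u / β) with hΛ
  have hΛ0 : 0 < Λ := by linarith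
  have hB : noiseBound n (d.size + 2 * u.size) β ≤ √(14 * n * Λ) := by
    rw [noiseBound]
    refine Real.sqrt_le_sqrt ?_
    calc 2 * (n : ℝ) * Real.log (18 * K / β) ≤ 2 * n * (7 * Λ) := by gcongr
      _ = 14 * n * Λ := by ring
  -- The number of levels is at most `8 l`, and here `l` is bounded by `Λ`; the factor `l ^ 2` in
  -- `τ` is needed only to absorb a constant.
  have hs : (√(ρ / 6) / √K)⁻¹ ≤ √(48 * Λ / ρ) := by
    rw [inv_div, ← Real.sqrt_div hK0.le]
    refine Real.sqrt_le_sqrt ?_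
    rw [div_div_eq_mul_div]
    exact div_le_div_of_nonneg_right (by linarith) hρ.le
  have hl2 : 0.475 ≤ l ^ 2 := by
    calc (0.475 : ℝ) ≤ 0.69 ^ 2 := by norm_num
      _ ≤ l ^ 2 := by gcongr; linarith
  calc 2 * noiseBound n (d.size + 2 * u.size) β / (√(ρ / 6) / √K)
      ≤ 2 * (√(14 * n * Λ) * √(48 * Λ / ρ)) := by
        rw [div_eq_mul_inv, mul_assoc]
        gcongr
    _ = 2 * √(n / ρ * (672 * Λ ^ 2)) := by
        rw [← Real.sqrt_mul (by positivity)]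
        congr 2
        ring
    _ ≤ 2 * √(n / ρ * (25.95 * Λ) ^ 2) := by
        gcongr
        nlinarith [sq_nonneg Λ]
    _ = 51.9 * √(n / ρ) * Λ := by
        rw [Real.sqrt_mul (by positivity), Real.sqrt_sq (by positivity)]
        ring
    _ ≤ 110 * √(n / ρ) * l ^ 2 * Λ := by
        gcongr ?_ * Λ
        have := mul_le_mul_of_nonneg_left hl2 (Real.sqrt_nonneg ((n : ℝ) / ρ))
        linarith [Real.sqrt_nonneg ((n : ℝ) / ρ)]
    _ = 110 * (√(n / ρ) * l ^ 2 * Λ) := by ring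

/-- The noise in the third round. -/
lemma shift_noise_le (hn : 2 ≤ n) (hd : 0 < d) (hρ : 0 < ρ) (h0 : 0 < β) (h1 : β < 1) :
    √2 / √(ρ / 6) * (√d * noiseBound n d β) ≤
      11 * √((d : ℝ) * n / ρ) * √(Real.log (n * d / β)) := by
  have hd' : (1 : ℝ) ≤ d := by exact_mod_cast hd
  have hn' : (2 : ℝ) ≤ n := by exact_mod_cast hn
  -- Here `n ≥ 2` is essential: for `n = d = 1` this logarithm can be arbitrarily small.
  have h2 : Real.log 2 ≤ Real.log (n * d / β) := by
    refine Real.log_le_log two_pos ?_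
    rw [le_div_iff₀ h0]
    nlinarith
  have hlog : Real.log (18 * d / β) ≤ 5 * Real.log (n * d / β) := by
    have hr : Real.log 9 ≤ (4 : ℕ) * Real.log (n * d / β) :=
      log_le_of_le_two_pow (k := 4) (by norm_num) (by norm_num) h2
    have hlog := log_const_mul_div_le (a := 9) (b := n * d) (β := β) (r := (4 : ℕ))
      (m := 18 * d) (by norm_num) (by positivity) h0 (by positivity) (by nlinarith)
      hr
    push_cast at hlog ⊢
    linarith
  have h4 := Real.log_two_gt_d9
  set ℓ := Real.log (n * d / β)
  have hl0 : 0 < ℓ := by linarith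
  rw [noiseBound, ← Real.sqrt_mul (by positivity), ← Real.sqrt_div (by positivity),
    ← Real.sqrt_mul (by positivity)]
  calc √(2 / (ρ / 6) * (d * (2 * n * Real.log (18 * d / β))))
      ≤ √(11 ^ 2 * ((d : ℝ) * n / ρ * ℓ)) := by
        refine Real.sqrt_le_sqrt ?_
        calc 2 / (ρ / 6) * (d * (2 * n * Real.log (18 * d / β)))
            ≤ 2 / (ρ / 6) * (d * (2 * n * (5 * ℓ))) := by gcongr
          _ = 120 * ((d : ℝ) * n / ρ * ℓ) := by field_simp; norm_num
          _ ≤ 11 ^ 2 * ((d : ℝ) * n / ρ * ℓ) := by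
            gcongr
            norm_num
    _ = 11 * √((d : ℝ) * n / ρ) * √ℓ := by
        rw [Real.sqrt_mul (by positivity), Real.sqrt_sq (by norm_num),
          Real.sqrt_mul (by positivity), mul_assoc]

lemma error_le {w : ℝ} (hw : 0 ≤ w) (hn : 2 ≤ n) (hdu : 2 ≤ d * u) (hρ : 0 < ρ) (h0 : 0 < β)
    (h1 : β < 1) :
    (2 * noiseBound n (d.size + 2 * u.size) β / (√(ρ / 6) / √(d.size + 2 * u.size : ℕ)) *
      (10 * w) + √2 * (10 * w) / √(ρ / 6) * (√d * noiseBound n d β)) / n ≤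
    2000 * ((√((d : ℝ) * n / ρ) + tau n d u ρ β) * √(Real.log (n * d / β))) * (w / n) := by
  have hd : 0 < d := Nat.pos_of_ne_zero (by rintro rfl; omega)
  have hd' : (1 : ℝ) ≤ d := by exact_mod_cast hd
  have hn' : (2 : ℝ) ≤ n := by exact_mod_cast hn
  have hM := dropped_le (n := n) hdu hρ h0 h1
  have hZ := shift_noise_le hn hd hρ h0 h1
  have h2 : Real.log 2 ≤ Real.log (n * d / β) := by
    refine Real.log_le_log two_pos ?_
    rw [le_div_iff₀ h0]
    nlinarith
  have hq : (0.8 : ℝ) ≤ √(Real.log (n * d / β)) := by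
    refine Real.le_sqrt_of_sq_le ?_
    have h4 := Real.log_two_gt_d9
    norm_num
    linarith
  have hτ : 0 ≤ tau n d u ρ β := by
    have h3 := log_mul_le_log_mul_div hdu h0 h1
    have h4 := log_two_le_log_mul hdu
    have h5 := Real.log_pos one_lt_two
    have h6 : 0 ≤ Real.log (d * u / β) := by linarith
    unfold tau
    positivity
  set Q := √((d : ℝ) * n / ρ)
  have hQ : 0 ≤ Q := Real.sqrt_nonneg _
  set q := √(Real.log (n * d / β))
  -- The dropped users carry no factor `q`; it is inserted at the price `1.25 = 1 / 0.8`.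
  have hτq : tau n d u ρ β ≤ 1.25 * (tau n d u ρ β * q) := by nlinarith
  have hQq : 0 ≤ Q * q := mul_nonneg hQ (by linarith)
  rw [mul_div_assoc', div_le_div_iff_of_pos_right (by linarith)]
  calc 2 * noiseBound n (d.size + 2 * u.size) β / (√(ρ / 6) / √(d.size + 2 * u.size : ℕ)) *
      (10 * w) + √2 * (10 * w) / √(ρ / 6) * (√d * noiseBound n d β)
      = 10 * (2 * noiseBound n (d.size + 2 * u.size) β /
          (√(ρ / 6) / √(d.size + 2 * u.size : ℕ)) +
          √2 / √(ρ / 6) * (√d * noiseBound n d β)) * w := by ring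
    _ ≤ 2000 * ((Q + tau n d u ρ β) * q) * w := by
        refine mul_le_mul_of_nonneg_right ?_ hw
        linarith

end

/-! ### The main theorem -/

/-- The noise bounds of the slots. -/
noncomputable def slotBound (n d L K : ℕ) (β : ℝ) : Slot d L K → ℝ :=
  Sum.elim (fun _ => noiseBound n (d * L) β)
    (Sum.elim (fun _ => noiseBound n K β) fun _ => noiseBound n d β)

/-- The thresholds of the slots. -/
noncomputable def slotThreshold (n d L K : ℕ) (β : ℝ) : Slot d L K → ℝ :=
  Sum.elim 0 (Sum.elim (fun _ => noiseBound n K β) 0)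

lemma noiseBound_nonneg (n m : ℕ) (β : ℝ) : 0 ≤ noiseBound n m β := Real.sqrt_nonneg _

lemma slotBound_nonneg (n d L K : ℕ) (β : ℝ) (k : Slot d L K) : 0 ≤ slotBound n d L K β k := by
  rcases k with p | k | j <;> exact noiseBound_nonneg _ _ _

lemma three_mul_sum_slotBound_le {n : ℕ} (hn : 0 < n) (d L K : ℕ) {β : ℝ} (h0 : 0 < β)
    (h1 : β < 1) :
    (3 : ℕ) * ∑ k, 2 * Real.exp (-slotBound n d L K β k ^ 2 / (2 * n)) ≤ β := by
  have hA := mul_two_exp_noiseBound_le hn (d * L) h0 h1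
  have hB := mul_two_exp_noiseBound_le hn K h0 h1
  have hC := mul_two_exp_noiseBound_le hn d h0 h1
  rw [Fintype.sum_sum_type, Fintype.sum_sum_type]
  simp only [slotBound, Sum.elim_inl, Sum.elim_inr, Finset.sum_const, Finset.card_univ,
    Fintype.card_prod, Fintype.card_fin, nsmul_eq_mul]
  push_cast at hA hB hC ⊢
  linarith

/-- The error bound holds whenever the noise is bounded. -/
lemma norm_estimateFrom_sub_mean_le_tau {n d u : ℕ} {ρ β : ℝ} (hn : 1 ≤ n) (hdu : 2 ≤ d * u)
    (hρ : 0 < ρ) (h0 : 0 < β) (h1 : β < 1) (hc : 100 * (tau n d u ρ β * √(d : ℝ)) ≤ n)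
    (D : Fin n → Datum d u) {L K : ℕ} (hL : L = u.size) (hK : K = d.size + 2 * L)
    {θ : Slot d L K → ℝ} (hθ₁ : ∀ p, θ (Sum.inl p) = 0)
    (hθ₂ : ∀ k, θ (Sum.inr (Sum.inl k)) = noiseBound n K β) {m₁ m₂ m₃ : Fin n → Slot d L K → ℝ}
    (hN₁ : ∀ p, |∑ i, (m₁ i (Sum.inl p) - codeMsg L √(ρ / 6) (D i) p)| ≤
      noiseBound n (d * L) β)
    (hN₂ : ∀ k, |∑ i, (m₂ i (Sum.inr (Sum.inl k)) -
      levelMsg K √(ρ / 6) (center (exceeds θ m₁)) (D i) k)| ≤ noiseBound n K β)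
    (hN₃ : ∀ j, |∑ i, (m₃ i (Sum.inr (Sum.inr j)) - shiftMsg √(ρ / 6) (center (exceeds θ m₁))
      (level (exceeds θ m₂)) (D i) j)| ≤ noiseBound n d β) :
    ‖estimateFrom L K √(ρ / 6) (exceeds θ m₁) (exceeds θ m₂) m₃ - mean D‖ ≤
      2000 * ((√((d : ℝ) * n / ρ) + tau n d u ρ β) * √(Real.log (n * d / β))) * (width D / n) := by
  have hd : 0 < d := Nat.pos_of_ne_zero (by rintro rfl; omega)
  have hs : 0 < √(ρ / 6) := Real.sqrt_pos.2 (by positivity)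
  have hw : 0 ≤ width D := Metric.diam_nonneg
  have hu : u < 2 ^ L := hL ▸ Nat.lt_size_self u
  have hK0 : 0 < K := hK ▸ Nat.add_pos_left (Nat.size_pos.2 hd) _
  have hnb : noiseBound n (d * L) β < √(ρ / 6) / √(d * L : ℕ) * (n / 2) :=
    hL ▸ noiseBound_lt hn hdu hρ h0 h1 hc
  have hcenter : ∀ i, ‖natPoint (center (exceeds θ m₁)) - (D i).toPoint‖ ≤ 10 * width D :=
    fun i => norm_center_sub_le hn (mul_sqDistVec_center_le L K hn hs hu hθ₁ hN₁ hnb i)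
  have hb : 0 < √(ρ / 6) / √K := div_pos hs (Real.sqrt_pos.2 (by exact_mod_cast hK0))
  have hlt : ∀ i, sqDistVec (center (exceeds θ m₁)) (D i).val < 2 ^ K := fun i =>
    (sqDistVec_lt L hu (center_lt L K (exceeds θ m₁)) (D i)).trans_eq (by rw [hK])
  have hcard := card_level_le hθ₂ hN₂ (noiseBound_nonneg n K β) hlt
  rw [mul_comm, ← le_div_iff₀ hb] at hcard
  have hR := sqrt_two_pow_level_le hθ₂ hN₂ (by positivity) hcenter
  have herr := norm_estimateFrom_sub_mean_le (by omega) hs (by positivity)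
    (noiseBound_nonneg n d β) hcenter hcard hR hN₃
  refine herr.trans ?_
  -- A single user has width zero, and then both bounds vanish.
  rcases Nat.lt_or_ge 1 n with hn2 | hn1
  · subst hL hK
    exact error_le hw hn2 hdu hρ h0 h1
  · have hw0 : width D = 0 := by
      have : Subsingleton (Fin n) := Fin.subsingleton_iff_le_one.2 hn1
      exact Metric.diam_subsingleton (Set.subsingleton_range _)
    simp [hw0]

end LDPMean

open LDPMean

theorem mainTheorem9 :
    ∃ c : ℝ, 0 < c ∧ ∃ C : ℝ, 0 < C ∧
      ∀ (n d u : ℕ) (ρ β : ℝ), 1 ≤ n → 2 ≤ d * u → 0 < ρ → 0 < β → β < 1 →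
        c * (LDPMean.tau n d u ρ β * √(d : ℝ)) ≤ (n : ℝ) →
        ∃ P : LDPMean.LocalProtocol n 3 (LDPMean.Datum d u) (EuclideanSpace ℝ (Fin d)),
          P.IsLocalZCDP ρ ∧
          ∀ D : Fin n → LDPMean.Datum d u,
            1 - β ≤ (P.law D).real
              {ω | ‖P.output ω - LDPMean.mean D‖ ≤
                C * ((√((d : ℝ) * n / ρ) + LDPMean.tau n d u ρ β) *
                  √(Real.log (n * d / β))) * (LDPMean.width D / n)} := by
  refine ⟨100, by norm_num, 2000, by norm_num, fun n d u ρ β hn hdu hρ h0 h1 hc => ?_⟩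
  set L := u.size
  set K := d.size + 2 * L
  set θ := slotThreshold n d L K β
  refine ⟨gaussProtocol (meanMsg L K √(ρ / 6) θ) (measurable_meanMsg L K _ θ)
    (estimate L K √(ρ / 6) θ) (measurable_estimate L K _ θ), ?_, fun D => ?_⟩
  · refine gaussProtocol_isLocalZCDP _ _ _ _ three_pos fun t h v =>
      (sum_meanMsg_sq_le L K _ θ t h v).trans (le_of_eq ?_)
    -- The scale `√(ρ / 6)` is the largest allowed by `ρ / (2 * T)` with `T = 3`.
    rw [Real.sq_sqrt (by positivity)]
    norm_num
  · refine le_gaussProtocol_law _ _ _ _ D (slotBound_nonneg n d L K β)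
      (three_mul_sum_slotBound_le hn d L K h0 h1) h0.le
      (S := {y | ‖y - mean D‖ ≤ 2000 * ((√((d : ℝ) * n / ρ) + tau n d u ρ β) *
        √(Real.log (n * d / β))) * (width D / n)})
      (measurableSet_le (by fun_prop) measurable_const)
      fun h hh => ?_
    obtain ⟨⟨⟨_, m₁⟩, m₂⟩, m₃⟩ := h
    obtain ⟨⟨⟨-, hN₁⟩, hN₂⟩, hN₃⟩ := hh
    exact norm_estimateFrom_sub_mean_le_tau hn hdu hρ h0 h1 hc D rfl rfl (θ := θ) (fun _ => rfl)
      (fun _ => rfl) (fun p => hN₁ (Sum.inl p)) (fun k => hN₂ (Sum.inr (Sum.inl k)))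
      (fun j => hN₃ (Sum.inr (Sum.inr j)))
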